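/- Let $\mathbb{K}$ be a field, let $R=\mathbb{K}[x_1,\dots,x_n,y_1,\dots,y_n]$ with the standard grading, and for a simple graph $G$ on the vertex set $[n]=\{1,\dots,n\}$ let $J_G=(x_iy_j-x_jy_i : \{i,j\}\in E(G))\subset R$ be its binomial edge ideal. For an ideal $I\subset R$ let $\operatorname{in}_{\rm lex}(I)$ be the ideal generated by the leading monomials of the nonzero elements of $I$ with respect to the lexicographic order induced by $x_1>\dots>x_n>y_1>\dots>y_n$. For a homogeneous ideal $I$ let $\beta_{i,j}(I)$ be the number of summands $R(-j)$ in the $i$-th free module of a minimal graded free resolution of $I$ as an $R$-module. The labeling of a graph on $[n]$ is called closed if any two distinct edges $\{i,j\}$, $\{k,l\}$ with $i<j$ and $k<l$ satisfy: $\{j,l\}\in E(G)$ if $i=k$, and $\{i,k\}\in E(G)$ if $j=l$. A graph is closed if its vertices can be relabeled by $1,\dots,n$ such that the resulting labeling is closed. **Theorem.** Let $G$ be a closed graph on $[n]$ that does not contain the complete graph $K_4$, with $e$ edges and $t$ triangles ($3$-cycles). Then for all $m\ge 1$ and $i\ge 0$ $$\beta_{i,2m+i}(J_G^m)=\binom{e+m-i-1}{m-i}\binom{2t}{i},$$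 and, whenever $G'$ is obtained from $G$ by relabeling the vertices such that the labeling of $G'$ is closed (in particular for $G'=G$ if the given labeling is closed), $$\beta_{i,2m+i}\bigl(\operatorname{in}_{\rm lex}(J_{G'})^m\bigr)=\binom{e+m-i-1}{m-i}\binom{2t}{i}.$$ Here $\binom{a}{b}=0$ for $b<0$, so all these numbers vanish for $i>m$, and $\binom{a}{0}=1$ for every integer $a$. -/

import Mathlib

open MvPolynomial

noncomputable section

namespace BinomialEdge

/-! ### Closed graphs -/

/-- The graph `G` on `{1, …, n}` (modelled by `Fin n`) satisfies the closedness condition for its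
given labeling: if two distinct edges share their smaller endpoint, or share their larger endpoint,
then the two other endpoints are adjacent. -/
def IsClosedLabeled {n : ℕ} (G : SimpleGraph (Fin n)) : Prop :=
  (∀ i j l : Fin n, i < j → i < l → j ≠ l → G.Adj i j → G.Adj i l → G.Adj j l) ∧
  (∀ i k j : Fin n, i < j → k < j → i ≠ k → G.Adj i j → G.Adj k j → G.Adj i k)

/-- The graph obtained from `G` by giving the vertex `v` the new label `τ v`. -/
def relabel {n : ℕ} (G : SimpleGraph (Fin n)) (τ : Equiv.Perm (Fin n)) : SimpleGraph (Fin n) :=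
  G.map τ.toEmbedding

/-- A graph is closed if some labeling of its vertices satisfies the closedness condition. -/
def IsClosedGraph {n : ℕ} (G : SimpleGraph (Fin n)) : Prop :=
  ∃ τ : Equiv.Perm (Fin n), IsClosedLabeled (relabel G τ)

/-! ### Binomial edge ideals and lexicographic initial ideals -/

/-- Index set of the variables `x₁, …, xₙ, y₁, …, yₙ`, linearly ordered as listed. -/
abbrev Vars (n : ℕ) : Type := Fin n ⊕ₗ Fin n

/-- The polynomial ring `K[x₁, …, xₙ, y₁, …, yₙ]`. -/
abbrev PolyRing (K : Type*) [Field K] (n : ℕ) : Type _ := MvPolynomial (Vars n) K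

/-- The variable `xᵢ`. -/
def x (K : Type*) [Field K] {n : ℕ} (i : Fin n) : PolyRing K n := X (Sum.inlₗ i)

/-- The variable `yᵢ`. -/
def y (K : Type*) [Field K] {n : ℕ} (i : Fin n) : PolyRing K n := X (Sum.inrₗ i)

/-- The binomial edge ideal `J_G`, generated by `xᵢ yⱼ - xⱼ yᵢ` for the edges `{i, j}` of `G`.
(Exchanging `i` and `j` only changes the sign of the generator.) -/
def binomialEdgeIdeal (K : Type*) [Field K] {n : ℕ} (G : SimpleGraph (Fin n)) :
    Ideal (PolyRing K n) :=
  Ideal.span {f | ∃ i j : Fin n, G.Adj i j ∧ f = x K i * y K j - x K j * y K i}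

/-- The initial ideal of `I` for the lexicographic order induced by
`x₁ > ⋯ > xₙ > y₁ > ⋯ > yₙ`: it is generated by the leading monomials of the nonzero elements
of `I`. -/
def lexInitialIdeal {K : Type*} [Field K] {n : ℕ} (I : Ideal (PolyRing K n)) :
    Ideal (PolyRing K n) :=
  Ideal.span {u | ∃ f ∈ I, f ≠ 0 ∧ u = monomial (MonomialOrder.lex.degree f) (1 : K)}

/-! ### Minimal graded free resolutions and graded Betti numbers -/

/-- For a list `a` of degrees, the vector `v` is a homogeneous element of degree `D` of the graded
free module `⨁ r, R(-a r)` over the standard graded polynomial ring `R`: its `r`-th coordinate is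
homogeneous of degree `D - a r` (hence zero if `D < a r`). -/
def IsHomogeneousVec {σ K : Type*} [Field K] {b : ℕ} (a : Fin b → ℕ)
    (v : Fin b → MvPolynomial σ K) (D : ℕ) : Prop :=
  ∀ r, ∀ s ∈ (v r).support, s.degree + a r = D

/-- A minimal graded free resolution `⋯ → F₂ → F₁ → F₀ → I → 0` of an ideal `I` of a standard
graded polynomial ring `R` over a field, with
`Fᵢ = ⨁ c, R(-(deg i c))`, where `c` runs through `Fin (rank i)`. -/
structure MinimalGradedFreeResolution {σ K : Type*} [Field K] (I : Ideal (MvPolynomial σ K)) where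
  /-- the rank of `Fᵢ` -/
  rank : ℕ → ℕ
  /-- the degrees of the basis elements of `Fᵢ` -/
  deg : ∀ i, Fin (rank i) → ℕ
  /-- the augmentation `F₀ → I ⊆ R` -/
  aug : (Fin (rank 0) → MvPolynomial σ K) →ₗ[MvPolynomial σ K] MvPolynomial σ K
  /-- the differential `Fᵢ₊₁ → Fᵢ` -/
  d : ∀ i, (Fin (rank (i + 1)) → MvPolynomial σ K) →ₗ[MvPolynomial σ K]
    (Fin (rank i) → MvPolynomial σ K)
  /-- the augmentation preserves degrees -/
  aug_homogeneous : ∀ c, (aug (Pi.single c 1)).IsHomogeneous (deg 0 c)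
  /-- the differentials preserve degrees -/
  d_homogeneous : ∀ i c, IsHomogeneousVec (deg i) (d i (Pi.single c 1)) (deg (i + 1) c)
  /-- the augmentation maps onto `I` -/
  range_aug : LinearMap.range aug = I
  /-- exactness at `F₀` -/
  exact_zero : LinearMap.range (d 0) = LinearMap.ker aug
  /-- exactness at `Fᵢ₊₁` -/
  exact_succ : ∀ i, LinearMap.range (d (i + 1)) = LinearMap.ker (d i)
  /-- minimality: the image of `Fᵢ₊₁ → Fᵢ` lies in `𝔪 Fᵢ`, where `𝔪` is generated by the
  variables -/
  minimal : ∀ i, LinearMap.range (d i) ≤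
    Ideal.span (Set.range (X : σ → MvPolynomial σ K)) •
      (⊤ : Submodule (MvPolynomial σ K) (Fin (rank i) → MvPolynomial σ K))

/-- The number of summands `R(-j)` in the `i`-th module of the resolution. -/
def MinimalGradedFreeResolution.betti {σ K : Type*} [Field K] {I : Ideal (MvPolynomial σ K)}
    (F : MinimalGradedFreeResolution I) (i j : ℕ) : ℕ :=
  (Finset.univ.filter fun c : Fin (F.rank i) => F.deg i c = j).card

/-- `βᵢⱼ(I) = b`: the ideal `I` has a minimal graded free resolution, and in each of them the number
of summands `R(-j)` in homological degree `i` is `b`. -/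
def HasGradedBetti {σ K : Type*} [Field K] (I : Ideal (MvPolynomial σ K)) (i j b : ℕ) : Prop :=
  Nonempty (MinimalGradedFreeResolution I) ∧
    ∀ F : MinimalGradedFreeResolution I, F.betti i j = b

/-- The number `C(e+m-i-1, m-i) · C(2t, i)`, where `C(a, b) = 0` for `b < 0`. -/
def linearStrandNumber (e t m i : ℕ) : ℕ :=
  if i ≤ m then (e + m - i - 1).choose (m - i) * (2 * t).choose i else 0

end BinomialEdge

end

noncomputable section

namespace BinomialEdge

/-! ### Graded free modules -/

section GradedFree

variable {σ K : Type*} [Field K]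

/-! Let S be the polynomial ring with one variable T_e for each edge e, and let f_e be the binomial
of e or its initial monomial. Both have the form x_i y_j - κ x_j y_i with i < j, for κ = 1 and κ =
0, and the triangle relations below only need κ² = κ, so both ideals are treated at once. The
numbers β_{i,2m+i} form the linear strand of J^m. Since J^m has nothing below degree 2m, this strand
depends only on the component of degree 2m and is found by taking linear syzygies over and over; any
linear complex of vector spaces with the same kernels computes it (`betti_eq_finrank`). The
component of degree 2m consists of the forms of degree m in the f_e, whatever generators of higher
degree J has (`pow_lowest_component`). Hence no Gröbner basis of J_G is needed, only the quadrics of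
the initial ideal. In a closed labeling without K_4 a vertex has at most two larger and at most two
smaller neighbours. Comparing exponents of initial monomials (`exists_reducible_of_lt`) then gives
two facts. The f_e are algebraically independent, so the component of degree 2m is S_m. The
relations ∑ v · p_v(f) = 0, with v running over the variables and p_v in S, form an S-module
generated by two relations per triangle, the expansions of a 3 × 3 determinant with a repeated row
(`linearEval_eq_zero_iff`). These 2t relations ℓ_a are independent over S, because a maximal minor
is nonzero (`det_pivot_ne_zero`), and the module they generate is saturated, because S embeds into a
domain. Linear algebra over the domain S now shows that the linear strand is the Koszul complex of
the ℓ_a: its i-th term is S_{m-i} ⊗ Λ^i K^{2t} (`betti_eq_of_linear_relations`), whose dimension is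
the asserted product of binomial coefficients. -/

/-- The homogeneous component of degree `D` of a vector of the graded free module with generator
degrees `a`. -/
def homProj {b : ℕ} (a : Fin b → ℕ) (D : ℕ) :
    (Fin b → MvPolynomial σ K) →ₗ[K] (Fin b → MvPolynomial σ K) where
  toFun v r := if a r ≤ D then homogeneousComponent (D - a r) (v r) else 0
  map_add' v w := by
    ext1 r
    by_cases h : a r ≤ D <;> simp [h]
  map_smul' c v := by
    ext1 r
    by_cases h : a r ≤ D <;> simp [h]

open Classical in
theorem coeff_homProj {b : ℕ} (a : Fin b → ℕ) (D : ℕ) (v : Fin b → MvPolynomial σ K)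
    (r : Fin b) (s : σ →₀ ℕ) :
    coeff s (homProj a D v r) = if s.degree + a r = D then coeff s (v r) else 0 := by
  simp only [homProj, LinearMap.coe_mk, AddHom.coe_mk]
  split_ifs with h1 h2 h2
  · rw [coeff_homogeneousComponent, if_pos (by omega)]
  · rw [coeff_homogeneousComponent, if_neg (by omega)]
  · omega
  · simp

theorem isHomogeneousVec_iff {b : ℕ} {a : Fin b → ℕ} {v : Fin b → MvPolynomial σ K} {D : ℕ} :
    IsHomogeneousVec a v D ↔ ∀ r s, coeff s (v r) ≠ 0 → s.degree + a r = D := by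
  simp [IsHomogeneousVec, mem_support_iff]

theorem isHomogeneousVec_homProj {b : ℕ} (a : Fin b → ℕ) (D : ℕ)
    (v : Fin b → MvPolynomial σ K) : IsHomogeneousVec a (homProj a D v) D := by
  classical
  rw [isHomogeneousVec_iff]
  intro r s h
  rw [coeff_homProj] at h
  by_contra h'
  simp [h'] at h

theorem IsHomogeneousVec.homProj_eq {b : ℕ} {a : Fin b → ℕ} {v : Fin b → MvPolynomial σ K} {D : ℕ}
    (h : IsHomogeneousVec a v D) : homProj a D v = v := by
  classical
  ext r s
  rw [coeff_homProj]
  split_ifs with hs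
  · rfl
  · by_contra hc
    exact hs (isHomogeneousVec_iff.1 h r s (Ne.symm hc))

theorem IsHomogeneousVec.homProj_of_ne {b : ℕ} {a : Fin b → ℕ} {v : Fin b → MvPolynomial σ K}
    {D D' : ℕ} (h : IsHomogeneousVec a v D) (hD : D ≠ D') : homProj a D' v = 0 := by
  classical
  ext r s
  rw [coeff_homProj]
  split_ifs with hs
  · by_contra hc
    exact hD ((isHomogeneousVec_iff.1 h r s hc).symm.trans hs)
  · simp

/-- The homogeneous vectors of a fixed degree form a subspace. -/
def homVec {b : ℕ} (a : Fin b → ℕ) (D : ℕ) : Submodule K (Fin b → MvPolynomial σ K) where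
  carrier := {v | IsHomogeneousVec a v D}
  zero_mem' := by simp [isHomogeneousVec_iff]
  add_mem' {v w} hv hw := by
    simp only [Set.mem_ofPred_eq, isHomogeneousVec_iff] at *
    intro r s h
    by_contra hc
    have h1 := not_imp_comm.1 (hv r s) hc
    have h2 := not_imp_comm.1 (hw r s) hc
    simp [h1, h2] at h
  smul_mem' c v hv := by
    simp only [Set.mem_ofPred_eq, isHomogeneousVec_iff] at *
    intro r s h
    refine hv r s fun h' => h ?_
    simp [h']

theorem mem_homVec {b : ℕ} {a : Fin b → ℕ} {D : ℕ} {v : Fin b → MvPolynomial σ K} :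
    v ∈ homVec a D ↔ IsHomogeneousVec a v D := Iff.rfl

theorem IsHomogeneousVec.monomial_smul {b : ℕ} {a : Fin b → ℕ} {v : Fin b → MvPolynomial σ K}
    {D : ℕ} (h : IsHomogeneousVec a v D) (s : σ →₀ ℕ) (c : K) :
    IsHomogeneousVec a (monomial s c • v) (s.degree + D) := by
  classical
  rw [isHomogeneousVec_iff] at *
  intro r t ht
  rw [Pi.smul_apply, smul_eq_mul, coeff_monomial_mul'] at ht
  split_ifs at ht with hst
  · have := h r _ (right_ne_zero_of_mul ht)
    have h2 : s + (t - s) = t := add_tsub_cancel_of_le hst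
    rw [← h2, map_add]
    omega
  · exact absurd rfl ht

theorem IsHomogeneousVec.X_smul {b : ℕ} {a : Fin b → ℕ} {v : Fin b → MvPolynomial σ K}
    {D : ℕ} (h : IsHomogeneousVec a v D) (i : σ) :
    IsHomogeneousVec a ((X i : MvPolynomial σ K) • v) (D + 1) := by
  have := h.monomial_smul (Finsupp.single i 1) 1
  rwa [Finsupp.degree_single, add_comm] at this

/-- Every vector is a combination of monomial multiples of basis vectors. -/
theorem vec_induction {b : ℕ} {P : (Fin b → MvPolynomial σ K) → Prop}
    (h0 : P 0) (hadd : ∀ v w, P v → P w → P (v + w))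
    (hmon : ∀ (r : Fin b) (s : σ →₀ ℕ) (c : K),
      P (monomial s c • (Pi.single r 1 : Fin b → MvPolynomial σ K))) (v : Fin b → MvPolynomial σ K) : P v := by
  have hr : ∀ r (p : MvPolynomial σ K), P (p • (Pi.single r 1 : Fin b → MvPolynomial σ K)) := by
    intro r p
    induction p using MvPolynomial.induction_on' with
    | monomial s c => exact hmon r s c
    | add p q hp hq => rw [add_smul]; exact hadd _ _ hp hq
  have hv : v = ∑ r, v r • (Pi.single r 1 : Fin b → MvPolynomial σ K) := by
    ext1 r
    simp [Finset.sum_apply, Pi.single_apply]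
  rw [hv]
  exact Finset.sum_induction _ P hadd h0 fun r _ => hr r _

theorem isHomogeneousVec_single {b : ℕ} (a : Fin b → ℕ) (r : Fin b) :
    IsHomogeneousVec a (Pi.single r (1 : MvPolynomial σ K)) (a r) := by
  classical
  rw [isHomogeneousVec_iff]
  intro r' s h
  by_cases hr : r' = r
  · subst hr
    rw [Pi.single_eq_same, coeff_one] at h
    have : s = 0 := by
      by_contra h'
      exact h (if_neg (Ne.symm h'))
    simp [this]
  · simp [hr] at h

theorem map_homProj {b b' : ℕ} {a : Fin b → ℕ} {a' : Fin b' → ℕ}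
    (d : (Fin b → MvPolynomial σ K) →ₗ[MvPolynomial σ K] (Fin b' → MvPolynomial σ K))
    (hd : ∀ c, IsHomogeneousVec a' (d (Pi.single c 1)) (a c)) (D : ℕ)
    (v : Fin b → MvPolynomial σ K) : d (homProj a D v) = homProj a' D (d v) := by
  induction v using vec_induction with
  | h0 => simp
  | hadd v w hv hw => simp [hv, hw]
  | hmon r s c =>
    have h1 := (isHomogeneousVec_single (K := K) (σ := σ) a r).monomial_smul s c
    have h2 := (hd r).monomial_smul s c
    rw [d.map_smul]
    by_cases h : s.degree + a r = D
    · rw [h] at h1 h2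
      rw [h1.homProj_eq, h2.homProj_eq, d.map_smul]
    · rw [h1.homProj_of_ne h, h2.homProj_of_ne h, map_zero]

theorem IsHomogeneousVec.map {b b' : ℕ} {a : Fin b → ℕ} {a' : Fin b' → ℕ}
    {d : (Fin b → MvPolynomial σ K) →ₗ[MvPolynomial σ K] (Fin b' → MvPolynomial σ K)}
    (hd : ∀ c, IsHomogeneousVec a' (d (Pi.single c 1)) (a c)) {D : ℕ}
    {v : Fin b → MvPolynomial σ K} (hv : IsHomogeneousVec a v D) :
    IsHomogeneousVec a' (d v) D := by
  rw [← hv.homProj_eq, map_homProj d hd]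
  exact isHomogeneousVec_homProj _ _ _

theorem exists_sum_homProj {b : ℕ} (a : Fin b → ℕ) (v : Fin b → MvPolynomial σ K) :
    ∃ N, v = ∑ D ∈ Finset.range N, homProj a D v := by
  classical
  -- Any bound above every total degree plus shift will do; the sum over r is one.
  refine ⟨∑ r, ((v r).totalDegree + a r) + 1, ?_⟩
  ext r s
  rw [Finset.sum_apply, coeff_sum]
  simp_rw [coeff_homProj]
  rw [Finset.sum_ite_eq]
  split_ifs with h
  · rfl
  · by_contra hc
    apply h
    have h1 : s.degree ≤ (v r).totalDegree := by
      have := le_totalDegree (mem_support_iff.2 hc)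
      exact this
    have h2 : (v r).totalDegree + a r ≤ ∑ r, ((v r).totalDegree + a r) :=
      Finset.single_le_sum (f := fun r => (v r).totalDegree + a r) (fun _ _ => Nat.zero_le _)
        (Finset.mem_univ r)
    rw [Finset.mem_range]
    omega

theorem constantCoeff_eq_zero_iff_mem {p : MvPolynomial σ K} :
    constantCoeff p = 0 ↔ p ∈ Ideal.span (Set.range (X : σ → MvPolynomial σ K)) := by
  rw [← Set.image_univ, mem_ideal_span_X_image]
  simp only [Set.mem_univ, true_and, constantCoeff_eq]
  constructor
  · intro h s hs
    by_contra! hc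
    have : s = 0 := Finsupp.ext hc
    subst this
    exact (mem_support_iff.1 hs) h
  · intro h
    by_contra hc
    obtain ⟨i, hi⟩ := h 0 (mem_support_iff.2 hc)
    simp at hi

/-- Turns minimality of a resolution into a condition on constant terms, entry by entry. -/
theorem mem_maximal_smul_iff {b : ℕ} {v : Fin b → MvPolynomial σ K} :
    v ∈ Ideal.span (Set.range (X : σ → MvPolynomial σ K)) •
      (⊤ : Submodule (MvPolynomial σ K) (Fin b → MvPolynomial σ K)) ↔
      ∀ r, constantCoeff (v r) = 0 := by
  constructor
  · intro h
    induction h using Submodule.smul_induction_on' with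
    | smul p hp w _ =>
      intro r
      rw [← constantCoeff_eq_zero_iff_mem] at hp
      simp [hp]
    | add v _ w _ hv hw =>
      intro r
      simp [hv r, hw r]
  · intro h
    have hv : v = ∑ r, v r • (Pi.single r 1 : Fin b → MvPolynomial σ K) := by
      ext1 r
      simp [Finset.sum_apply, Pi.single_apply]
    rw [hv]
    exact Submodule.sum_mem _ fun r _ =>
      Submodule.smul_mem_smul (constantCoeff_eq_zero_iff_mem.1 (h r)) trivial

/-! ### Existence of minimal graded free resolutions -/

variable [Finite σ]

theorem exists_homogeneous_generators {b : ℕ} (a : Fin b → ℕ)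
    (M : Submodule (MvPolynomial σ K) (Fin b → MvPolynomial σ K))
    (hM : ∀ v ∈ M, ∀ D, homProj a D v ∈ M) :
    ∃ (c : ℕ) (w : Fin c → Fin b → MvPolynomial σ K),
      (∀ i, ∃ D, IsHomogeneousVec a (w i) D) ∧
      Submodule.span (MvPolynomial σ K) (Set.range w) = M := by
  set S : Set (Fin b → MvPolynomial σ K) := {v | v ∈ M ∧ ∃ D, IsHomogeneousVec a v D}
  have hS : Submodule.span (MvPolynomial σ K) S = M := by
    refine le_antisymm (Submodule.span_le.2 fun v hv => hv.1) fun v hv => ?_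
    obtain ⟨N, hN⟩ := exists_sum_homProj a v
    rw [hN]
    exact Submodule.sum_mem _ fun D _ => Submodule.subset_span
      ⟨hM v hv D, D, isHomogeneousVec_homProj a D v⟩
  obtain ⟨T, hTS, hT⟩ := Submodule.fg_span_iff_fg_span_finset_subset S |>.1
    (IsNoetherian.noetherian (Submodule.span (MvPolynomial σ K) S))
  refine ⟨T.card, fun i => (T.equivFin.symm i : Fin b → MvPolynomial σ K), fun i =>
    (hTS (T.equivFin.symm i).2).2, ?_⟩
  rw [← hS, hT]
  congr 1
  ext v
  constructor
  · rintro ⟨i, rfl⟩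
    exact (T.equivFin.symm i).2
  · intro hv
    exact ⟨T.equivFin ⟨v, hv⟩, by simp⟩

/-- Graded Nakayama: take the least possible number of homogeneous generators. A syzygy with a
nonzero constant term in some entry would make that generator superfluous. -/
theorem exists_minimal_generators {b : ℕ} (a : Fin b → ℕ)
    (M : Submodule (MvPolynomial σ K) (Fin b → MvPolynomial σ K))
    (hM : ∀ v ∈ M, ∀ D, homProj a D v ∈ M) :
    ∃ (c : ℕ) (deg : Fin c → ℕ)
      (d : (Fin c → MvPolynomial σ K) →ₗ[MvPolynomial σ K] (Fin b → MvPolynomial σ K)),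
      (∀ i, IsHomogeneousVec a (d (Pi.single i 1)) (deg i)) ∧
      LinearMap.range d = M ∧
      ∀ v, d v = 0 → ∀ r, constantCoeff (v r) = 0 := by
  classical
  have hex := exists_homogeneous_generators a M hM
  set c := Nat.find hex with hc
  obtain ⟨w, hw, hspan⟩ := Nat.find_spec hex
  choose deg hdeg using hw
  set d := Fintype.linearCombination (MvPolynomial σ K) w with hd
  have hd1 : ∀ i, d (Pi.single i 1) = w i := fun i => by
    simp [hd, Fintype.linearCombination_apply_single]
  have hhom : ∀ i, IsHomogeneousVec a (d (Pi.single i 1)) (deg i) := fun i => by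
    rw [hd1]; exact hdeg i
  refine ⟨c, deg, d, hhom, (Fintype.range_linearCombination _ _).trans hspan, fun v hv r => ?_⟩
  by_contra hr
  -- In this degree the r-th entry of the syzygy is exactly a scalar, so it can be inverted.
  set u := homProj deg (deg r) v with hu
  have hdu : d u = 0 := by rw [hu, map_homProj d hhom, hv, map_zero]
  have hur : u r = C (constantCoeff (v r)) := by
    simp [hu, homProj, homogeneousComponent_zero, constantCoeff_eq]
  have hmem : w r ∈ Submodule.span (MvPolynomial σ K) (w '' {i | i ≠ r}) := by
    have h1 : ∑ i, u i • w i = 0 := by rw [← hdu, hd, Fintype.linearCombination_apply]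
    rw [← Finset.add_sum_erase _ _ (Finset.mem_univ r), hur] at h1
    have h2 : w r = -(C (constantCoeff (v r))⁻¹ : MvPolynomial σ K) •
        ∑ i ∈ Finset.univ.erase r, u i • w i := by
      rw [neg_smul, ← smul_neg, ← eq_neg_of_add_eq_zero_left h1, smul_smul, ← C_mul,
        inv_mul_cancel₀ hr, C_1, one_smul]
    rw [h2]
    refine Submodule.smul_mem _ _ (Submodule.sum_mem _ fun i hi => Submodule.smul_mem _ _
      (Submodule.subset_span ⟨i, Finset.ne_of_mem_erase hi, rfl⟩))
  have hpos : 0 < c := lt_of_le_of_lt (Nat.zero_le _) r.2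
  have hcard : Fintype.card {i : Fin c // i ≠ r} = c - 1 := by simp
  let e := (Fintype.equivFinOfCardEq hcard).symm
  refine Nat.find_min hex (m := c - 1) (by omega)
    ⟨fun i => w (e i), fun i => ⟨_, hdeg _⟩, ?_⟩
  rw [← hspan]
  refine le_antisymm (Submodule.span_mono ?_) (Submodule.span_le.2 ?_)
  · rintro _ ⟨i, rfl⟩
    exact ⟨_, rfl⟩
  · have himg : Set.range (fun i => w (e i)) = w '' {i | i ≠ r} := by
      ext z
      constructor
      · rintro ⟨i, rfl⟩
        exact ⟨e i, (e i).2, rfl⟩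
      · rintro ⟨i, hi, rfl⟩
        exact ⟨e.symm ⟨i, hi⟩, by simp⟩
    rw [himg]
    rintro _ ⟨i, rfl⟩
    by_cases hi : i = r
    · subst hi; exact hmem
    · exact Submodule.subset_span ⟨i, hi, rfl⟩

/-- A graded submodule of a graded free module of finite rank. -/
structure GradedSub (σ K : Type*) [Field K] where
  /-- the rank of the ambient free module -/
  rank : ℕ
  /-- the degrees of its basis -/
  deg : Fin rank → ℕ
  /-- the submodule -/
  sub : Submodule (MvPolynomial σ K) (Fin rank → MvPolynomial σ K)
  /-- the submodule is graded -/
  graded : ∀ v ∈ sub, ∀ D, homProj deg D v ∈ sub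

namespace GradedSub

/-- The rank of a minimal free cover. -/
def coverRank (M : GradedSub σ K) : ℕ :=
  (exists_minimal_generators M.deg M.sub M.graded).choose

/-- The degrees of a minimal free cover. -/
def coverDeg (M : GradedSub σ K) : Fin M.coverRank → ℕ :=
  (exists_minimal_generators M.deg M.sub M.graded).choose_spec.choose

/-- A minimal free cover. -/
def cover (M : GradedSub σ K) :
    (Fin M.coverRank → MvPolynomial σ K) →ₗ[MvPolynomial σ K] (Fin M.rank → MvPolynomial σ K) :=
  (exists_minimal_generators M.deg M.sub M.graded).choose_spec.choose_spec.choose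

theorem cover_spec (M : GradedSub σ K) :
    (∀ i, IsHomogeneousVec M.deg (M.cover (Pi.single i 1)) (M.coverDeg i)) ∧
      LinearMap.range M.cover = M.sub ∧
      ∀ v, M.cover v = 0 → ∀ r, constantCoeff (v r) = 0 :=
  (exists_minimal_generators M.deg M.sub M.graded).choose_spec.choose_spec.choose_spec

/-- The syzygy module of a graded submodule with respect to its minimal free cover. -/
def syz (M : GradedSub σ K) : GradedSub σ K where
  rank := M.coverRank
  deg := M.coverDeg
  sub := LinearMap.ker M.cover
  graded v hv D := by
    rw [LinearMap.mem_ker] at *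
    rw [map_homProj M.cover M.cover_spec.1, hv, map_zero]

/-- The minimal free cover of the syzygy module, as a map between free modules. -/
def syzMap (M : GradedSub σ K) : (Fin M.syz.coverRank → MvPolynomial σ K) →ₗ[MvPolynomial σ K]
    (Fin M.coverRank → MvPolynomial σ K) :=
  M.syz.cover

theorem range_syzMap (M : GradedSub σ K) : LinearMap.range M.syzMap = LinearMap.ker M.cover :=
  M.syz.cover_spec.2.1

theorem range_syzMap_le (M : GradedSub σ K) : LinearMap.range M.syzMap ≤
    Ideal.span (Set.range (X : σ → MvPolynomial σ K)) •
      (⊤ : Submodule (MvPolynomial σ K) (Fin M.coverRank → MvPolynomial σ K)) := by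
  rw [range_syzMap]
  exact fun v hv => mem_maximal_smul_iff.2 (M.cover_spec.2.2 v hv)

/-- Iterated syzygy modules. -/
def syzIter (M : GradedSub σ K) : ℕ → GradedSub σ K
  | 0 => M
  | i + 1 => (syzIter M i).syz

/-- The resolution consists of iterated minimal covers of syzygy modules. The map `pr` carries the
bottom module into the ring, and its injectivity leaves the kernel of the first cover unchanged. -/
theorem nonempty_resolution (M : GradedSub σ K) {I : Ideal (MvPolynomial σ K)}
    (pr : (Fin M.rank → MvPolynomial σ K) →ₗ[MvPolynomial σ K] MvPolynomial σ K)
    (hinj : LinearMap.ker pr = ⊥) (hrange : M.sub.map pr = I)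
    (hdeg : ∀ v D, IsHomogeneousVec M.deg v D → (pr v).IsHomogeneous D) :
    Nonempty (MinimalGradedFreeResolution I) := by
  have h0 : LinearMap.range (pr ∘ₗ M.cover) = I := by
    rw [LinearMap.range_comp, M.cover_spec.2.1, hrange]
  have h1 : LinearMap.range M.syzMap = LinearMap.ker (pr ∘ₗ M.cover) := by
    rw [range_syzMap, LinearMap.ker_comp, hinj]
    rfl
  exact ⟨{
    rank := fun i => (M.syzIter i).coverRank
    deg := fun i => (M.syzIter i).coverDeg
    aug := pr ∘ₗ M.cover
    d := fun i => (M.syzIter i).syzMap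
    aug_homogeneous := fun c => hdeg _ _ (M.cover_spec.1 c)
    d_homogeneous := fun i c => (M.syzIter (i + 1)).cover_spec.1 c
    range_aug := h0
    exact_zero := h1
    exact_succ := fun i => (M.syzIter (i + 1)).range_syzMap
    minimal := fun i => (M.syzIter i).range_syzMap_le }⟩

end GradedSub

/-- A homogeneous ideal has a minimal graded free resolution. -/
theorem nonempty_minimalGradedFreeResolution {I : Ideal (MvPolynomial σ K)}
    (hI : ∀ p ∈ I, ∀ D, homogeneousComponent D p ∈ I) :
    Nonempty (MinimalGradedFreeResolution I) := by
  let pr : (Fin 1 → MvPolynomial σ K) →ₗ[MvPolynomial σ K] MvPolynomial σ K := LinearMap.proj 0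
  refine GradedSub.nonempty_resolution
    { rank := 1
      deg := fun _ => 0
      sub := Submodule.comap pr I
      graded := fun v hv D => by
        simpa [pr, homProj] using hI _ hv D } pr ?_ ?_ ?_
  · refine LinearMap.ker_eq_bot'.2 fun v hv => ?_
    ext1 i
    rw [Subsingleton.elim i 0]
    exact hv
  · exact Submodule.map_comap_eq_of_surjective (fun p => ⟨fun _ => p, rfl⟩) _
  · intro v D h s hs
    have := isHomogeneousVec_iff.1 h 0 s hs
    rwa [add_zero, Finsupp.degree_eq_weight_one] at this

end GradedFree

/-! ### The linear strand of a minimal resolution -/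

/-- The terms cancel in pairs under swapping the indices. The diagonal is a separate hypothesis so
that characteristic two is covered. -/
theorem sum_sum_eq_zero_of_alternating {σ M : Type*} [Fintype σ] [AddCommGroup M] {z : σ → σ → M}
    (h1 : ∀ a b, a ≠ b → z a b + z b a = 0) (h2 : ∀ a, z a a = 0) : ∑ a, ∑ b, z a b = 0 := by
  rw [← Finset.sum_product']
  refine Finset.sum_involution (fun p _ => (p.2, p.1)) ?_ ?_ ?_ ?_
  · rintro ⟨a, b⟩ -
    by_cases h : a = b
    · subst h; simp [h2]
    · exact h1 a b h
  · rintro ⟨a, b⟩ - h h'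
    have : a = b := (Prod.ext_iff.1 h').2
    subst this
    exact h (h2 _)
  · simp
  · simp

theorem coeff_mul_C {σ R : Type*} [CommSemiring R] (s : σ →₀ ℕ) (p : MvPolynomial σ R) (c : R) :
    coeff s (p * C c) = coeff s p * c := by
  rw [mul_comm, coeff_C_mul, mul_comm]

theorem sum_C_mul_X_mul_X_eq_zero_iff {σ K : Type*} [Fintype σ] [Field K] (k : σ → σ → K) :
    ∑ a, ∑ b, (X a * X b : MvPolynomial σ K) * C (k a b) = 0 ↔
      (∀ a b, a ≠ b → k a b + k b a = 0) ∧ ∀ a, k a a = 0 := by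
  classical
  constructor
  · intro h
    have hc : ∀ v w, ∑ a, ∑ b,
        (if Finsupp.single a 1 + Finsupp.single b 1 = Finsupp.single v 1 + Finsupp.single w (1 : ℕ)
          then k a b else 0) = 0 := by
      intro v w
      have := congrArg (coeff (Finsupp.single v 1 + Finsupp.single w 1)) h
      simp only [coeff_sum, coeff_zero] at this
      refine Eq.trans ?_ this
      refine Finset.sum_congr rfl fun a _ => Finset.sum_congr rfl fun b _ => ?_
      rw [coeff_mul_C, X, X, monomial_mul, coeff_monomial]
      split_ifs <;> simp
    have hs : ∀ a b v w : σ,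
        Finsupp.single a 1 + Finsupp.single b 1 = Finsupp.single v 1 + Finsupp.single w (1 : ℕ) ↔
          (a = v ∧ b = w) ∨ (a = w ∧ b = v) := by
      intro a b v w
      rw [Finsupp.single_add_single_eq_single_add_single one_ne_zero one_ne_zero]
      aesop
    constructor
    · intro v w hvw
      have := hc v w
      simp_rw [hs] at this
      rw [← Finset.sum_product', Finset.univ_product_univ,
        ← Finset.sum_subset (Finset.subset_univ {(v, w), (w, v)})] at this
      · rw [Finset.sum_pair (by simp [hvw])] at this
        simpa using this
      · rintro ⟨a, b⟩ - hab
        simp only [Finset.mem_insert, Finset.mem_singleton, Prod.mk.injEq] at hab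
        rw [if_neg hab]
    · intro v
      have := hc v v
      simp_rw [hs, or_self] at this
      rw [← this, Finset.sum_eq_single v, Finset.sum_eq_single v] <;> simp +contextual
  · rintro ⟨h1, h2⟩
    refine sum_sum_eq_zero_of_alternating (fun a b hab => ?_) fun a => by simp [h2]
    rw [mul_comm (X b), ← mul_add, ← C_add, h1 a b hab, C_0, mul_zero]

section Strand

variable {σ K : Type*} [Field K]

namespace MinimalGradedFreeResolution

variable {I : Ideal (MvPolynomial σ K)} (F : MinimalGradedFreeResolution I) {D : ℕ}

theorem aug_mem (v) : F.aug v ∈ I := by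
  have : F.aug v ∈ LinearMap.range F.aug := ⟨v, rfl⟩
  rwa [F.range_aug] at this

theorem single_not_mem_range (i : ℕ) (c : Fin (F.rank i)) :
    (Pi.single c 1 : Fin (F.rank i) → MvPolynomial σ K) ∉ LinearMap.range (F.d i) := by
  intro h
  have := mem_maximal_smul_iff.1 (F.minimal i h) c
  simp at this

/-- A basis vector of too small degree is killed by the next map: by the lower bound on I for the
augmentation, and for a differential because its image could only have constant entries, which
minimality excludes. By exactness it would then lie in the image of a minimal differential, which is
impossible. -/
theorem le_deg (hlow : ∀ p ∈ I, ∀ k < D, homogeneousComponent k p = 0) :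
    ∀ i c, D + i ≤ F.deg i c
  | 0, c => by
    by_contra! hc
    have h1 : F.aug (Pi.single c 1) ∈ I := F.aug_mem _
    have h2 := hlow _ h1 _ hc
    rw [homogeneousComponent_eq_self (F.aug_homogeneous c)] at h2
    refine F.single_not_mem_range 0 c ?_
    rw [F.exact_zero]
    exact h2
  | i + 1, c => by
    by_contra! hc
    refine F.single_not_mem_range (i + 1) c ?_
    rw [F.exact_succ, LinearMap.mem_ker]
    ext r s
    by_contra h
    have h1 := isHomogeneousVec_iff.1 (F.d_homogeneous i c) r s h
    have h2 := le_deg hlow i r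
    have h3 : s = 0 := by
      rw [← Finsupp.degree_eq_zero_iff]
      omega
    subst h3
    exact h (mem_maximal_smul_iff.1 (F.minimal i ⟨_, rfl⟩) r)

variable {F}

theorem homVec_eq_zero (hlow : ∀ p ∈ I, ∀ k < D, homogeneousComponent k p = 0)
    {i k : ℕ} (hk : k < D + i) {v : Fin (F.rank i) → MvPolynomial σ K}
    (hv : v ∈ homVec (F.deg i) k) : v = 0 := by
  ext r s
  by_contra h
  have h1 := isHomogeneousVec_iff.1 hv r s h
  have h2 := F.le_deg hlow i r
  omega

/-- In the lowest possible degree D + i there is no room for variables, so the strand is a space of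
constant vectors. -/
theorem eq_C_of_mem_homVec (hlow : ∀ p ∈ I, ∀ k < D, homogeneousComponent k p = 0)
    {i : ℕ} {v : Fin (F.rank i) → MvPolynomial σ K}
    (hv : v ∈ homVec (F.deg i) (D + i)) (r : Fin (F.rank i)) : v r = C (constantCoeff (v r)) := by
  classical
  ext s
  rw [coeff_C, constantCoeff_eq]
  split_ifs with h
  · rw [h]
  · by_contra hc
    have h1 := isHomogeneousVec_iff.1 hv r s hc
    have h2 := F.le_deg hlow i r
    refine h (Eq.symm ((Finsupp.degree_eq_zero_iff _).1 ?_))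
    omega

theorem finrank_homVec (hlow : ∀ p ∈ I, ∀ k < D, homogeneousComponent k p = 0)
    (i : ℕ) : Module.finrank K (homVec (σ := σ) (K := K) (F.deg i) (D + i)) =
    F.betti i (D + i) := by
  classical
  let e : homVec (σ := σ) (K := K) (F.deg i) (D + i) ≃ₗ[K] ({c : Fin (F.rank i) // F.deg i c = D + i} → K) :=
    { toFun := fun v c => constantCoeff (v.1 c)
      map_add' := fun v w => by ext; simp
      map_smul' := fun a v => by ext; simp
      invFun := fun g => ⟨fun r => if h : F.deg i r = D + i then C (g ⟨r, h⟩) else 0, by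
        rw [mem_homVec, isHomogeneousVec_iff]
        intro r s h
        split_ifs at h with h'
        · rw [coeff_C] at h
          have : s = 0 := by
            by_contra hs
            exact h (if_neg (Ne.symm hs))
          simp [this, h']
        · simp at h⟩
      left_inv := fun v => by
        ext1
        funext r
        dsimp only
        split_ifs with h
        · exact (eq_C_of_mem_homVec hlow v.2 r).symm
        · rw [eq_C_of_mem_homVec hlow v.2 r]
          by_contra hc
          have : coeff 0 (v.1 r) ≠ 0 := by
            intro h0
            rw [constantCoeff_eq, h0, C_0] at hc
            exact hc rfl
          have := isHomogeneousVec_iff.1 v.2 r 0 this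
          rw [map_zero, zero_add] at this
          exact h this
      right_inv := fun g => by
        ext c
        simp [c.2] }
  rw [e.finrank_eq, Module.finrank_pi, Fintype.card_subtype]
  rfl

theorem exists_homVec_of_mem_range {i k : ℕ} {z : Fin (F.rank i) → MvPolynomial σ K}
    (hz : z ∈ homVec (F.deg i) k) (h : z ∈ LinearMap.range (F.d i)) :
    ∃ y ∈ homVec (F.deg (i + 1)) k, F.d i y = z := by
  obtain ⟨y, rfl⟩ := h
  refine ⟨homProj (F.deg (i + 1)) k y, isHomogeneousVec_homProj _ _ _, ?_⟩
  rw [map_homProj _ (F.d_homogeneous i), IsHomogeneousVec.homProj_eq hz]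

theorem eq_zero_of_mem_range (hlow : ∀ p ∈ I, ∀ k < D, homogeneousComponent k p = 0)
    {i : ℕ} {z : Fin (F.rank i) → MvPolynomial σ K}
    (hz : z ∈ homVec (F.deg i) (D + i)) (h : z ∈ LinearMap.range (F.d i)) : z = 0 := by
  obtain ⟨y, hy, rfl⟩ := exists_homVec_of_mem_range hz h
  rw [homVec_eq_zero hlow (by omega) hy, map_zero]

/-- An element of the strand killed by the differential is a boundary, and nothing of this degree
exists one step further up. -/
theorem d_injOn (hlow : ∀ p ∈ I, ∀ k < D, homogeneousComponent k p = 0)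
    {i : ℕ} {y : Fin (F.rank (i + 1)) → MvPolynomial σ K}
    (hy : y ∈ homVec (F.deg (i + 1)) (D + (i + 1))) (h : F.d i y = 0) : y = 0 := by
  refine eq_zero_of_mem_range hlow hy ?_
  rw [F.exact_succ]
  exact h

variable [Fintype σ]

/-- On the strand the differential is given by linear forms: minimality removes constants and the
degree bound removes everything above degree one. -/
theorem exists_d_eq_sum (hlow : ∀ p ∈ I, ∀ k < D, homogeneousComponent k p = 0)
    {i : ℕ} {y : Fin (F.rank (i + 1)) → MvPolynomial σ K}
    (hy : y ∈ homVec (F.deg (i + 1)) (D + (i + 1))) :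
    ∃ z : σ → Fin (F.rank i) → MvPolynomial σ K, (∀ v, z v ∈ homVec (F.deg i) (D + i)) ∧
      F.d i y = ∑ v, (X v : MvPolynomial σ K) • z v := by
  classical
  have hd : IsHomogeneousVec (F.deg i) (F.d i y) (D + (i + 1)) :=
    IsHomogeneousVec.map (F.d_homogeneous i) hy
  rw [isHomogeneousVec_iff] at hd
  refine ⟨fun v r => C (coeff (Finsupp.single v 1) (F.d i y r)), fun v => ?_, ?_⟩
  · rw [mem_homVec, isHomogeneousVec_iff]
    intro r s h
    rw [coeff_C] at h
    split_ifs at h with hs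
    · have := hd r _ h
      rw [Finsupp.degree_single] at this
      rw [← hs, map_zero]
      omega
    · exact absurd rfl h
  · ext r s
    rw [Finset.sum_apply, coeff_sum]
    simp only [Pi.smul_apply, smul_eq_mul, coeff_mul_C, coeff_X]
    by_cases h : coeff s (F.d i y r) = 0
    · rw [h]
      refine Eq.symm (Finset.sum_eq_zero fun v _ => ?_)
      split_ifs with hs
      · rw [hs, h, mul_zero]
      · rw [zero_mul]
    · have h1 := hd r s h
      have h2 := F.le_deg hlow i r
      have h3 : s ≠ 0 := by
        rintro rfl
        exact h (mem_maximal_smul_iff.1 (F.minimal i ⟨_, rfl⟩) r)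
      have h4 : s.degree = 1 := by
        have : s.degree ≠ 0 := fun h0 => h3 ((Finsupp.degree_eq_zero_iff _).1 h0)
        omega
      obtain ⟨v, rfl⟩ : s ∈ Set.range fun v : σ => Finsupp.single v 1 := by
        rw [Finsupp.range_single_one]
        exact h4
      rw [Finset.sum_eq_single v]
      · simp
      · intro w _ hw
        rw [if_neg, zero_mul]
        exact fun h => hw (Finsupp.single_left_injective one_ne_zero h)
      · simp

theorem eq_zero_of_sum_X_smul (hlow : ∀ p ∈ I, ∀ k < D, homogeneousComponent k p = 0)
    {i : ℕ} {z : σ → Fin (F.rank i) → MvPolynomial σ K}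
    (hz : ∀ v, z v ∈ homVec (F.deg i) (D + i))
    (h : ∑ v, (X v : MvPolynomial σ K) • z v = 0) (v : σ) : z v = 0 := by
  classical
  ext1 r
  rw [eq_C_of_mem_homVec hlow (hz v) r]
  have h1 := congrArg (fun p => coeff (Finsupp.single v 1) (p r)) h
  simp only [Finset.sum_apply, coeff_sum, Pi.smul_apply, smul_eq_mul] at h1
  have h2 : ∀ w, coeff (Finsupp.single v 1) (X w * z w r) =
      if w = v then constantCoeff (z v r) else 0 := by
    intro w
    rw [eq_C_of_mem_homVec hlow (hz w) r, coeff_mul_C, coeff_X]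
    by_cases hwv : w = v
    · subst hwv; simp
    · rw [if_neg hwv, if_neg, zero_mul]
      exact fun h => hwv (Finsupp.single_left_injective one_ne_zero h)
  simp_rw [h2] at h1
  simpa using h1

theorem sum_X_mul_X_smul_eq_zero_iff (hlow : ∀ p ∈ I, ∀ k < D, homogeneousComponent k p = 0)
    {i : ℕ} {z : σ → σ → Fin (F.rank i) → MvPolynomial σ K}
    (hz : ∀ v w, z v w ∈ homVec (F.deg i) (D + i)) :
    ∑ v, ∑ w, (X v * X w : MvPolynomial σ K) • z v w = 0 ↔
      (∀ v w, v ≠ w → z v w + z w v = 0) ∧ ∀ v, z v v = 0 := by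
  constructor
  · intro h
    have hr := fun r => (sum_C_mul_X_mul_X_eq_zero_iff
      (fun a b => constantCoeff (z a b r))).1 (by
        have := congrFun h r
        simp only [Finset.sum_apply, Pi.smul_apply, smul_eq_mul] at this
        simp_rw [← eq_C_of_mem_homVec hlow (hz _ _) r]
        exact this)
    constructor
    · intro v w hvw
      ext1 r
      rw [Pi.add_apply, eq_C_of_mem_homVec hlow (hz v w) r, eq_C_of_mem_homVec hlow (hz w v) r,
        ← C_add, (hr r).1 v w hvw]
      simp
    · intro v
      ext1 r
      rw [eq_C_of_mem_homVec hlow (hz v v) r, (hr r).2 v]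
      simp
  · rintro ⟨h1, h2⟩
    refine sum_sum_eq_zero_of_alternating (fun a b hab => ?_) fun a => by simp [h2]
    rw [mul_comm (X b), ← smul_add, h1 a b hab, smul_zero]

end MinimalGradedFreeResolution

variable [Fintype σ]

open MinimalGradedFreeResolution in
/-- The graded Betti numbers in the linear strand are determined by any linear complex of vector
spaces `⋯ → W₂ → W₁ → W₀` (with maps given by linear forms) that is exact in the linear strand. -/
theorem betti_eq_finrank {I : Ideal (MvPolynomial σ K)} (F : MinimalGradedFreeResolution I) {D : ℕ}
    (hlow : ∀ p ∈ I, ∀ k < D, homogeneousComponent k p = 0)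
    {V : Type*} [AddCommGroup V] [Module K V] (W : ℕ → Submodule K V)
    (del : V →ₗ[K] (σ → V)) (ε : V →ₗ[K] MvPolynomial σ K)
    (hε : ∀ w ∈ W 0, ε w ∈ I ∧ (ε w).IsHomogeneous D)
    (hεinj : ∀ w ∈ W 0, ε w = 0 → w = 0)
    (hεsurj : ∀ p ∈ I, p.IsHomogeneous D → ∃ w ∈ W 0, ε w = p)
    (hdel : ∀ i, ∀ w ∈ W (i + 1), ∀ v, del w v ∈ W i)
    (hdelinj : ∀ i, ∀ w ∈ W (i + 1), del w = 0 → w = 0)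
    (hex0 : ∀ u : σ → V, (∀ v, u v ∈ W 0) →
      (∑ v, X v * ε (u v) = 0 ↔ ∃ w ∈ W 1, del w = u))
    (hex : ∀ i, ∀ u : σ → V, (∀ v, u v ∈ W (i + 1)) →
      (((∀ v v', v ≠ v' → del (u v) v' + del (u v') v = 0) ∧ ∀ v, del (u v) v = 0) ↔
        ∃ w ∈ W (i + 2), del w = u))
    (i : ℕ) : F.betti i (D + i) = Module.finrank K (W i) := by
  -- The induction carries an isomorphism φ from W i to the strand, together with the description of
  -- its linear boundaries; the last clause is what identifies the next term.
  have main : ∀ i, ∃ φ : V →ₗ[K] (Fin (F.rank i) → MvPolynomial σ K),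
      (∀ w ∈ W i, φ w ∈ homVec (F.deg i) (D + i)) ∧ (∀ w ∈ W i, φ w = 0 → w = 0) ∧
      (∀ h ∈ homVec (F.deg i) (D + i), ∃ w ∈ W i, φ w = h) ∧
      (∀ u : σ → V, (∀ v, u v ∈ W i) →
        (∑ v, (X v : MvPolynomial σ K) • φ (u v) ∈ LinearMap.range (F.d i) ↔
          ∃ w ∈ W (i + 1), del w = u)) := by
    intro i
    induction i with
    | zero =>
      let augK : homVec (F.deg 0) D →ₗ[K] MvPolynomial σ K :=
        (F.aug.restrictScalars K) ∘ₗ (homVec (F.deg 0) D).subtype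
      have hk : LinearMap.ker augK = ⊥ := by
        refine LinearMap.ker_eq_bot'.2 fun h hh => ?_
        have := eq_zero_of_mem_range (F := F) hlow (i := 0) (z := h.1) h.2 (by
          rw [F.exact_zero]
          exact hh)
        exact Subtype.ext this
      -- The inverse of the augmentation on its image is extended to all polynomials, so that φ is
      -- linear on all of V; its values outside W 0 play no role.
      obtain ⟨g, hg⟩ := augK.exists_leftInverse_of_injective hk
      have hg' : ∀ h, g (augK h) = h := fun h => LinearMap.congr_fun hg h
      have haugdeg : ∀ h ∈ homVec (F.deg 0) D, (F.aug h).IsHomogeneous D := by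
        intro h hh
        -- Viewing a polynomial as a vector of length one makes the lemmas on graded maps apply to
        -- the augmentation.
        let ι : MvPolynomial σ K →ₗ[MvPolynomial σ K] (Fin 1 → MvPolynomial σ K) :=
          LinearMap.pi fun _ => LinearMap.id
        have h1 : IsHomogeneousVec (fun _ : Fin 1 => 0) ((ι ∘ₗ F.aug) h) D := by
          refine IsHomogeneousVec.map (fun c => ?_) hh
          rw [isHomogeneousVec_iff]
          intro r s hs
          rw [add_zero, Finsupp.degree_eq_weight_one]
          exact F.aug_homogeneous c hs
        intro s hs
        have := isHomogeneousVec_iff.1 h1 0 s hs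
        rwa [add_zero, Finsupp.degree_eq_weight_one] at this
      have hlift : ∀ w ∈ W 0, ∃ h : homVec (F.deg 0) D, augK h = ε w := by
        intro w hw
        obtain ⟨h1, h2⟩ := hε w hw
        rw [← F.range_aug] at h1
        obtain ⟨y, hy⟩ := h1
        refine ⟨⟨homProj (F.deg 0) D y, isHomogeneousVec_homProj _ _ _⟩, ?_⟩
        have hN := exists_sum_homProj (F.deg 0) y
        have hcomp : ∀ k, (F.aug (homProj (F.deg 0) k y)) = homogeneousComponent k (F.aug y) := by
          intro k
          let ι : MvPolynomial σ K →ₗ[MvPolynomial σ K] (Fin 1 → MvPolynomial σ K) :=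
            LinearMap.pi fun _ => LinearMap.id
          have := map_homProj (a' := fun _ : Fin 1 => 0) (ι ∘ₗ F.aug) (fun c => by
            rw [isHomogeneousVec_iff]
            intro r s hs
            rw [add_zero, Finsupp.degree_eq_weight_one]
            exact F.aug_homogeneous c hs) k y
          have := congrFun this 0
          simpa [ι, homProj] using this
        change F.aug (homProj (F.deg 0) D y) = ε w
        rw [hcomp, hy, homogeneousComponent_eq_self h2]
      have hφ : ∀ w ∈ W 0, F.aug (g (ε w)).1 = ε w := by
        intro w hw
        obtain ⟨h, hh⟩ := hlift w hw
        rw [← hh, hg']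
        rfl
      refine ⟨(homVec (F.deg 0) D).subtype ∘ₗ g ∘ₗ ε, fun w _ => (g (ε w)).2, ?_, ?_, ?_⟩
      · intro w hw h
        refine hεinj w hw ?_
        rw [← hφ w hw, show (g (ε w)).1 = 0 from h, map_zero]
      · intro h hh
        obtain ⟨w, hw, hw'⟩ := hεsurj (F.aug h) (F.aug_mem h)
          (haugdeg h hh)
        refine ⟨w, hw, ?_⟩
        have := hg' ⟨h, hh⟩
        change (g (ε w)).1 = h
        rw [hw']
        exact congrArg Subtype.val this
      · intro u hu
        rw [← hex0 u hu, F.exact_zero, LinearMap.mem_ker, map_sum]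
        simp only [map_smul, smul_eq_mul]
        refine Eq.congr_left (Finset.sum_congr rfl fun v _ => ?_)
        exact congrArg _ (hφ _ (hu v))
    | succ i ih =>
      obtain ⟨φ, h1, h2, h3, h4⟩ := ih
      let H := homVec (σ := σ) (K := K) (F.deg (i + 1)) (D + (i + 1))
      let dK : H →ₗ[K] (Fin (F.rank i) → MvPolynomial σ K) :=
        ((F.d i).restrictScalars K) ∘ₗ H.subtype
      have hk : LinearMap.ker dK = ⊥ := by
        refine LinearMap.ker_eq_bot'.2 fun h hh => ?_
        exact Subtype.ext (d_injOn (F := F) hlow h.2 hh)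
      obtain ⟨g, hg⟩ := dK.exists_leftInverse_of_injective hk
      have hg' : ∀ h, g (dK h) = h := fun h => LinearMap.congr_fun hg h
      -- Φ is what the differential of the new φ has to be; φ itself is Φ followed by the inverse of
      -- the differential.
      let Φ : V →ₗ[K] (Fin (F.rank i) → MvPolynomial σ K) :=
        ∑ v : σ, (LinearMap.lsmul (MvPolynomial σ K) _ (X v : MvPolynomial σ K)).restrictScalars K ∘ₗ
          φ ∘ₗ LinearMap.proj v ∘ₗ del
      have hΦ : ∀ w, Φ w = ∑ v, (X v : MvPolynomial σ K) • φ (del w v) := by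
        intro w
        simp [Φ, LinearMap.sum_apply]
      have hφ : ∀ w ∈ W (i + 1), F.d i (g (Φ w)).1 = Φ w := by
        intro w hw
        have hr : Φ w ∈ LinearMap.range (F.d i) := by
          rw [hΦ, h4 _ (hdel i w hw)]
          exact ⟨w, hw, rfl⟩
        have hh : Φ w ∈ homVec (F.deg i) (D + (i + 1)) := by
          rw [hΦ]
          exact Submodule.sum_mem _ fun v _ =>
            IsHomogeneousVec.X_smul (h1 _ (hdel i w hw v)) v
        obtain ⟨y, hy, hy'⟩ := exists_homVec_of_mem_range hh hr
        have : dK ⟨y, hy⟩ = Φ w := hy'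
        rw [← this, hg']
        rfl
      refine ⟨H.subtype ∘ₗ g ∘ₗ Φ, fun w _ => (g (Φ w)).2, ?_, ?_, ?_⟩
      · intro w hw h
        refine hdelinj i w hw ?_
        have h0 : Φ w = 0 := by
          rw [← hφ w hw, show (g (Φ w)).1 = 0 from h, map_zero]
        rw [hΦ] at h0
        ext1 v
        exact h2 _ (hdel i w hw v)
          (eq_zero_of_sum_X_smul hlow (fun v => h1 _ (hdel i w hw v)) h0 v)
      · intro h hh
        obtain ⟨z, hz, hz'⟩ := exists_d_eq_sum hlow hh
        choose u hu hu' using fun v => h3 (z v) (hz v)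
        have hd : ∑ v, (X v : MvPolynomial σ K) • φ (u v) = F.d i h := by
          simp_rw [hu', hz']
        obtain ⟨w, hw, hwu⟩ := (h4 u hu).1 (by rw [hd]; exact ⟨h, rfl⟩)
        refine ⟨w, hw, ?_⟩
        change (g (Φ w)).1 = h
        have : Φ w = dK ⟨h, hh⟩ := by
          rw [hΦ, hwu, hd]
          rfl
        rw [this, hg']
      · intro u hu
        -- Exactness replaces "is a boundary" by "is a cycle", and comparing the coefficients of the
        -- products of two variables turns the cycle condition into the alternating condition of
        -- `hex`.
        rw [← hex i u hu, F.exact_succ, LinearMap.mem_ker, map_sum]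
        have e1 : ∀ v, F.d i ((X v : MvPolynomial σ K) • (H.subtype ∘ₗ g ∘ₗ Φ) (u v)) =
            ∑ v', (X v * X v' : MvPolynomial σ K) • φ (del (u v) v') := by
          intro v
          rw [map_smul]
          change (X v : MvPolynomial σ K) • F.d i (g (Φ (u v))).1 = _
          rw [hφ _ (hu v), hΦ, Finset.smul_sum]
          simp_rw [smul_smul]
        simp_rw [e1]
        have hd := fun v v' => hdel i _ (hu v) v'
        rw [sum_X_mul_X_smul_eq_zero_iff hlow (fun v v' => h1 _ (hd v v'))]
        refine and_congr (forall_congr' fun v => forall_congr' fun v' => imp_congr_right fun _ => ?_)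
          (forall_congr' fun v => ?_)
        · rw [← map_add]
          exact ⟨h2 _ (Submodule.add_mem _ (hd v v') (hd v' v)), fun h => by rw [h, map_zero]⟩
        · exact ⟨h2 _ (hd v v), fun h => by rw [h, map_zero]⟩
  obtain ⟨φ, h1, h2, h3, -⟩ := main i
  rw [← finrank_homVec hlow i]
  let e : W i →ₗ[K] homVec (F.deg i) (D + i) := (φ ∘ₗ (W i).subtype).codRestrict _ fun w =>
    h1 w.1 w.2
  refine (LinearEquiv.finrank_eq (LinearEquiv.ofBijective e ⟨?_, ?_⟩)).symm
  · rw [← LinearMap.ker_eq_bot, LinearMap.ker_eq_bot']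
    intro w hw
    exact Subtype.ext (h2 w.1 w.2 (congrArg Subtype.val hw))
  · rintro ⟨h, hh⟩
    obtain ⟨w, hw, hwh⟩ := h3 h hh
    exact ⟨⟨w, hw⟩, Subtype.ext hwh⟩

end Strand

/-! ### Graded pieces of polynomials -/

theorem homogeneousComponent_add_mul {σ K : Type*} [CommSemiring K] {p : MvPolynomial σ K} {d : ℕ}
    (hp : p.IsHomogeneous d) (q : MvPolynomial σ K) (k : ℕ) :
    homogeneousComponent (d + k) (p * q) = p * homogeneousComponent k q := by
  classical
  conv_lhs => rw [← sum_homogeneousComponent q, Finset.mul_sum, map_sum]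
  have h : ∀ j, homogeneousComponent (d + k) (p * homogeneousComponent j q) =
      if j = k then p * homogeneousComponent k q else 0 := by
    intro j
    rw [homogeneousComponent_of_mem (hp.mul (homogeneousComponent_isHomogeneous j q))]
    by_cases hj : j = k
    · subst hj; simp
    · rw [if_neg (by omega), if_neg hj]
  simp_rw [h]
  rw [Finset.sum_ite_eq']
  split_ifs with hk
  · rfl
  · rw [homogeneousComponent_eq_zero, mul_zero]
    rw [Finset.mem_range] at hk
    omega

theorem homogeneousComponent_mul_of_lt {σ K : Type*} [CommSemiring K] {p : MvPolynomial σ K} {d : ℕ}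
    (hp : p.IsHomogeneous d) (q : MvPolynomial σ K) {k : ℕ} (hk : k < d) :
    homogeneousComponent k (p * q) = 0 := by
  classical
  rw [← sum_homogeneousComponent q, Finset.mul_sum, map_sum]
  refine Finset.sum_eq_zero fun j _ => ?_
  rw [homogeneousComponent_of_mem (hp.mul (homogeneousComponent_isHomogeneous j q)),
    if_neg (by omega)]

/-- The homogeneous component of degree `m - i`, and `0` if `m < i`. -/
def shiftComponent {E K : Type*} [Field K] (m i : ℕ) : MvPolynomial E K →ₗ[K] MvPolynomial E K :=
  if i ≤ m then homogeneousComponent (m - i) else 0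

theorem shiftComponent_linear_mul {E K : Type*} [Field K] {l : MvPolynomial E K}
    (hl : l.IsHomogeneous 1) (m i : ℕ) (p : MvPolynomial E K) :
    shiftComponent m i (l * p) = l * shiftComponent m (i + 1) p := by
  unfold shiftComponent
  by_cases h : i + 1 ≤ m
  · rw [if_pos h, if_pos (by omega), show m - i = 1 + (m - (i + 1)) by omega,
      homogeneousComponent_add_mul hl]
  · rw [if_neg h]
    split_ifs with h'
    · rw [show m - i = 0 by omega, homogeneousComponent_mul_of_lt hl _ one_pos]
      simp
    · simp

open Classical in
theorem coeff_shiftComponent {E K : Type*} [Field K] (m i : ℕ) (p : MvPolynomial E K) (s : E →₀ ℕ) :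
    coeff s (shiftComponent m i p) = if s.degree + i = m then coeff s p else 0 := by
  unfold shiftComponent
  split_ifs with h1 h2 h2
  · rw [coeff_homogeneousComponent, if_pos (by omega)]
  · rw [coeff_homogeneousComponent, if_neg (by omega)]
  · omega
  · simp

/-! ### The Koszul complex in its linear strand -/

section Koszul

variable {A ρ σ : Type*} [CommRing A] [LinearOrder ρ]

/-- The sign of the face `J` of `insert a J` (zero if `a ∈ J`). -/
def koszulSign (A : Type*) [CommRing A] (a : ρ) (J : Finset ρ) : A :=
  if a ∈ J then 0 else (-1) ^ (J.filter (· < a)).card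

theorem koszulSign_of_mem {a : ρ} {J : Finset ρ} (h : a ∈ J) : koszulSign A a J = 0 := if_pos h

theorem koszulSign_insert_self (a : ρ) (J : Finset ρ) : koszulSign A a (insert a J) = 0 :=
  koszulSign_of_mem (Finset.mem_insert_self a J)

theorem koszulSign_mul_self {a : ρ} {J : Finset ρ} (h : a ∉ J) :
    koszulSign A a J * koszulSign A a J = 1 := by
  rw [koszulSign, if_neg h, ← pow_add, ← two_mul, pow_mul]
  simp

/-- Inserting a adds one element below b, while inserting b adds none below a; this single factor -1
is the anticommutation. -/
theorem koszulSign_insert_mul_of_lt {a b : ρ} (hab : a < b) (J : Finset ρ) :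
    koszulSign A b (insert a J) * koszulSign A a J =
      -(koszulSign A a (insert b J) * koszulSign A b J) := by
  by_cases ha : a ∈ J
  · rw [koszulSign_of_mem ha, koszulSign_of_mem (Finset.mem_insert_of_mem ha)]
    simp
  by_cases hb : b ∈ J
  · rw [koszulSign_of_mem hb, koszulSign_of_mem (Finset.mem_insert_of_mem hb)]
    simp
  have h1 : (insert a J).filter (· < b) = insert a (J.filter (· < b)) := by
    rw [Finset.filter_insert, if_pos hab]
  have h2 : (insert b J).filter (· < a) = J.filter (· < a) := by
    rw [Finset.filter_insert, if_neg hab.not_gt]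
  rw [koszulSign, koszulSign, koszulSign, koszulSign, if_neg ha, if_neg hb,
    if_neg (by simp [hab.ne', hb]), if_neg (by simp [hab.ne, ha]), h1, h2,
    Finset.card_insert_of_notMem (by simp [ha]), pow_succ]
  ring

theorem koszulSign_insert_mul {a b : ρ} (hab : a ≠ b) (J : Finset ρ) :
    koszulSign A b (insert a J) * koszulSign A a J =
      -(koszulSign A a (insert b J) * koszulSign A b J) := by
  rcases hab.lt_or_gt with h | h
  · exact koszulSign_insert_mul_of_lt h J
  · rw [koszulSign_insert_mul_of_lt h J, neg_neg]

theorem koszulSign_cases (a : ρ) (J : Finset ρ) :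
    koszulSign A a J = 0 ∨ koszulSign A a J = 1 ∨ koszulSign A a J = -1 := by
  unfold koszulSign
  split_ifs
  · exact Or.inl rfl
  · exact Or.inr (neg_one_pow_eq_or A _)

variable [Fintype ρ]

/-- The coordinate at the variable `v` of the Koszul differential of the linear forms
`ℓ a = ∑ v, ℓ a v • v`. -/
def koszulDel (ℓ : ρ → σ → A) (c : Finset ρ → A) (v : σ) (J : Finset ρ) : A :=
  ∑ a, koszulSign A a J * (ℓ a v * c (insert a J))

variable {ℓ : ρ → σ → A}

theorem koszulDel_koszulDel (c : Finset ρ → A) (v w : σ) (J : Finset ρ) :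
    koszulDel ℓ (koszulDel ℓ c v) w J = ∑ b, ∑ a, (koszulSign A a (insert b J) * koszulSign A b J) *
      (ℓ a v * ℓ b w * c (insert a (insert b J))) := by
  unfold koszulDel
  refine Finset.sum_congr rfl fun b _ => ?_
  rw [Finset.mul_sum, Finset.mul_sum]
  refine Finset.sum_congr rfl fun a _ => ?_
  ring

/-- This is ∂∂ = 0 for the Koszul complex, read off on the coefficients of the products of two
variables. -/
theorem koszulDel_alternating (c : Finset ρ → A) :
    (∀ v w, v ≠ w → koszulDel ℓ (koszulDel ℓ c v) w + koszulDel ℓ (koszulDel ℓ c w) v = 0) ∧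
      ∀ v, koszulDel ℓ (koszulDel ℓ c v) v = 0 := by
  constructor
  · intro v w _
    ext1 J
    rw [Pi.add_apply, koszulDel_koszulDel, koszulDel_koszulDel, ← Finset.sum_add_distrib]
    simp_rw [← Finset.sum_add_distrib]
    refine sum_sum_eq_zero_of_alternating (fun a b hab => ?_) fun a => ?_
    · rw [koszulSign_insert_mul hab, Finset.insert_comm]
      ring
    · rw [koszulSign_insert_self]
      ring
  · intro v
    ext1 J
    rw [koszulDel_koszulDel]
    refine sum_sum_eq_zero_of_alternating (fun a b hab => ?_) fun a => ?_
    · rw [koszulSign_insert_mul hab, Finset.insert_comm]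
      ring
    · rw [koszulSign_insert_self]
      ring

/-- A family of coefficients `Λ J b` satisfying the compatibility conditions of a Koszul boundary
comes from a Koszul chain. -/
theorem exists_koszulDel_eq (Λ : Finset ρ → ρ → A) (h0 : ∀ J, ∀ b ∈ J, Λ J b = 0)
    (h1 : ∀ J a b, a ∉ J → b ∉ J → a ≠ b →
      koszulSign A b (insert a J) * Λ (insert a J) b =
        koszulSign A a (insert b J) * Λ (insert b J) a) :
    ∃ c : Finset ρ → A, ∀ v J, koszulDel ℓ c v J = ∑ b, Λ J b * ℓ b v := by
  classical
  -- The value at L is read off by removing the least element; the compatibility condition says that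
  -- removing any other element gives the same value. No boundary involves c ∅, so 0 is as good as
  -- anything.
  let c : Finset ρ → A := fun L => if h : L.Nonempty then
    koszulSign A (L.min' h) (L.erase (L.min' h)) * Λ (L.erase (L.min' h)) (L.min' h) else 0
  have hc : ∀ J b, b ∉ J → c (insert b J) = koszulSign A b J * Λ J b := by
    intro J b hb
    have hne : (insert b J).Nonempty := Finset.insert_nonempty b J
    simp only [c, dif_pos hne]
    set a := (insert b J).min' hne with ha
    have hmem : a ∈ insert b J := Finset.min'_mem _ _
    by_cases hab : a = b
    · rw [hab, Finset.erase_insert hb]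
    · have haJ : a ∈ J := Finset.mem_of_mem_insert_of_ne hmem hab
      have hJ : J = insert a (J.erase a) := (Finset.insert_erase haJ).symm
      have hJ2 : (insert b J).erase a = insert b (J.erase a) :=
        Finset.erase_insert_of_ne (Ne.symm hab)
      rw [hJ2, ← h1 (J.erase a) a b (Finset.notMem_erase a J)
        (fun h => hb (Finset.mem_of_mem_erase h)) hab, ← hJ]
  refine ⟨c, fun v J => Finset.sum_congr rfl fun b _ => ?_⟩
  by_cases hb : b ∈ J
  · rw [koszulSign_of_mem hb, h0 J b hb]
    ring
  · rw [hc J b hb]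
    linear_combination (Λ J b * ℓ b v) * koszulSign_mul_self (A := A) hb

/-! ### Exactness of the Koszul complex in linear degree over a domain. -/

variable [Fintype σ] [IsDomain A] {θ : ρ → σ → A} {Δ : A}

/-- The vectors θ b are dual to the ℓ a up to the factor Δ, so pairing with θ b isolates Δ · μ b. -/
theorem coeff_eq_zero_of_dual
    (hθ : ∀ a b, ∑ v, θ b v * ℓ a v = if a = b then Δ else 0) (hΔ : Δ ≠ 0) {μ : ρ → A}
    (h : ∀ v, ∑ a, μ a * ℓ a v = 0) (b : ρ) : μ b = 0 := by
  have h1 : ∑ v, θ b v * ∑ a, μ a * ℓ a v = Δ * μ b := by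
    simp_rw [Finset.mul_sum]
    rw [Finset.sum_comm]
    have : ∀ a, ∑ v, θ b v * (μ a * ℓ a v) = if a = b then Δ * μ b else 0 := by
      intro a
      have := congrArg (μ a * ·) (hθ a b)
      simp only [Finset.mul_sum] at this
      rw [Finset.sum_congr rfl fun v _ => (mul_left_comm (θ b v) (μ a) (ℓ a v)), this]
      split_ifs with hab
      · rw [hab, mul_comm]
      · rw [mul_zero]
    simp_rw [this]
    simp
  simp_rw [h, mul_zero, Finset.sum_const_zero] at h1
  exact (mul_eq_zero.1 h1.symm).resolve_left hΔ

/-- A relation ∑ ℓ_a q_a = 0 between linear forms is a Koszul relation. Contraction with θ shows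
that Δ q_b is a combination of the ℓ_a, and `hsat` removes Δ. The coefficients inherit the
alternating property because a double contraction returns them up to Δ². -/
theorem exists_alternating_coeff
    (hθ : ∀ a b, ∑ v, θ b v * ℓ a v = if a = b then Δ else 0) (hΔ : Δ ≠ 0)
    (hsat : ∀ (p : σ → A) (μ : ρ → A), (∀ v, Δ * p v = ∑ a, μ a * ℓ a v) →
      ∃ μ : ρ → A, ∀ v, p v = ∑ a, μ a * ℓ a v)
    (q : ρ → σ → A)
    (h1 : ∀ v w, v ≠ w → ∑ a, ℓ a v * q a w + ∑ a, ℓ a w * q a v = 0)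
    (h2 : ∀ v, ∑ a, ℓ a v * q a v = 0) :
    ∃ μ : ρ → ρ → A, (∀ a v, q a v = ∑ b, μ a b * ℓ b v) ∧ (∀ a b, μ a b = -μ b a) ∧
      ∀ a, μ a a = 0 := by
  have hB : ∀ v w, ∑ a, ℓ a v * q a w = -∑ a, ℓ a w * q a v := by
    intro v w
    by_cases h : v = w
    · subst h; rw [h2]; simp
    · exact eq_neg_of_add_eq_zero_left (h1 v w h)
  have hD : ∀ b w, Δ * q b w = ∑ v, θ b v * ∑ a, ℓ a v * q a w := by
    intro b w
    simp_rw [Finset.mul_sum]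
    rw [Finset.sum_comm]
    have : ∀ a, ∑ v, θ b v * (ℓ a v * q a w) = if a = b then Δ * q b w else 0 := by
      intro a
      simp_rw [← mul_assoc]
      rw [← Finset.sum_mul, hθ]
      split_ifs with hab
      · rw [hab]
      · rw [zero_mul]
    simp_rw [this]
    simp
  have hex : ∀ b, ∃ μ : ρ → A, ∀ v, q b v = ∑ a, μ a * ℓ a v := by
    intro b
    -- The coefficients come from `hD` after exchanging the two variables by `hB`, which puts the
    -- free index on ℓ instead of q.
    refine hsat (q b) (fun a => -∑ v, θ b v * q a v) fun w => ?_
    rw [hD]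
    simp_rw [hB _ w, mul_neg, Finset.mul_sum, neg_mul, Finset.sum_mul]
    rw [Finset.sum_neg_distrib, Finset.sum_neg_distrib, Finset.sum_comm]
    congr 1
    refine Finset.sum_congr rfl fun a _ => Finset.sum_congr rfl fun v _ => ?_
    ring
  choose μ hμ using hex
  have hval : ∀ b d, ∑ w, θ d w * ∑ v, θ b v * ∑ a, ℓ a v * q a w = Δ * Δ * μ b d := by
    intro b d
    simp_rw [← hD, hμ, Finset.mul_sum]
    rw [Finset.sum_comm]
    have : ∀ a, ∑ w, θ d w * (Δ * (μ b a * ℓ a w)) = if a = d then Δ * Δ * μ b d else 0 := by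
      intro a
      have := congrArg (Δ * μ b a * ·) (hθ a d)
      simp only [Finset.mul_sum] at this
      rw [Finset.sum_congr rfl fun v _ =>
        (show θ d v * (Δ * (μ b a * ℓ a v)) = Δ * μ b a * (θ d v * ℓ a v) by ring), this]
      split_ifs with hab
      · rw [hab]; ring
      · rw [mul_zero]
    simp_rw [this]
    simp
  have hΔ2 : Δ * Δ ≠ 0 := mul_ne_zero hΔ hΔ
  refine ⟨μ, hμ, fun b d => ?_, fun b => ?_⟩
  · refine mul_left_cancel₀ hΔ2 ?_
    rw [mul_neg, ← hval, ← hval, eq_neg_iff_add_eq_zero]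
    have e : ∑ w, θ b w * ∑ v, θ d v * ∑ a, ℓ a v * q a w =
        ∑ w, θ d w * ∑ v, θ b v * ∑ a, ℓ a w * q a v := by
      simp_rw [Finset.mul_sum]
      rw [Finset.sum_comm]
      refine Finset.sum_congr rfl fun v _ => Finset.sum_congr rfl fun w _ => ?_
      refine Finset.sum_congr rfl fun a _ => ?_
      ring
    rw [e, ← Finset.sum_add_distrib]
    refine Finset.sum_eq_zero fun w _ => ?_
    rw [← mul_add, ← Finset.sum_add_distrib]
    refine mul_eq_zero_of_right _ (Finset.sum_eq_zero fun v _ => ?_)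
    rw [← mul_add, hB v w, neg_add_cancel, mul_zero]
  · refine (mul_eq_zero.1 ?_).resolve_left hΔ2
    rw [← hval]
    rw [Finset.sum_congr rfl fun w _ => Finset.mul_sum _ _ _]
    refine sum_sum_eq_zero_of_alternating (fun v w _ => ?_) fun v => by rw [h2]; ring
    rw [hB v w]
    ring

/-- Exactness of the Koszul complex in linear degree: a chain with linear coefficients and
vanishing differential is the boundary of a chain with constant coefficients. -/
theorem exists_koszulDel_of_alternating
    (hθ : ∀ a b, ∑ v, θ b v * ℓ a v = if a = b then Δ else 0) (hΔ : Δ ≠ 0)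
    (hsat : ∀ (p : σ → A) (μ : ρ → A), (∀ v, Δ * p v = ∑ a, μ a * ℓ a v) →
      ∃ μ : ρ → A, ∀ v, p v = ∑ a, μ a * ℓ a v)
    (u : σ → Finset ρ → A) (hu : ∀ v, u v ∅ = 0)
    (h1 : ∀ v w, v ≠ w → koszulDel ℓ (u v) w + koszulDel ℓ (u w) v = 0)
    (h2 : ∀ v, koszulDel ℓ (u v) v = 0) : ∃ c, koszulDel ℓ c = u := by
  have hsw : ∀ v w J, ∑ a, ℓ a v * (koszulSign A a J * u w (insert a J)) =
      koszulDel ℓ (u w) v J := by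
    intro v w J
    exact Finset.sum_congr rfl fun a _ => by ring
  -- For fixed J the entries of u at the sets J ∪ {a} are the coefficients of a relation between the
  -- ℓ a.
  have hex : ∀ J, ∃ μ : ρ → ρ → A,
      (∀ a v, koszulSign A a J * u v (insert a J) = ∑ b, μ a b * ℓ b v) ∧
      (∀ a b, μ a b = -μ b a) ∧ ∀ a, μ a a = 0 := by
    intro J
    refine exists_alternating_coeff hθ hΔ hsat (fun a v => koszulSign A a J * u v (insert a J))
      (fun v w hvw => ?_) fun v => ?_
    · rw [hsw, hsw, add_comm]
      exact congrFun (h1 v w hvw) J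
    · rw [hsw, h2]
      rfl
  choose μ hμ hanti hdiag using hex
  -- A nonempty J has the form J' ∪ {a}, so the previous step applied to J' expresses its entries
  -- through the ℓ b.
  have hΛ : ∀ J : Finset ρ, ∃ Λ : ρ → A, ∀ v, u v J = ∑ b, Λ b * ℓ b v := by
    intro J
    rcases J.eq_empty_or_nonempty with rfl | ⟨a, ha⟩
    · exact ⟨0, fun v => by simp [hu]⟩
    · refine ⟨fun b => koszulSign A a (J.erase a) * μ (J.erase a) a b, fun v => ?_⟩
      simp_rw [mul_assoc]
      rw [← Finset.mul_sum, ← hμ, Finset.insert_erase ha, ← mul_assoc,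
        koszulSign_mul_self (Finset.notMem_erase a J), one_mul]
  choose Λ hΛ using hΛ
  have hΛ0 : ∀ b, Λ ∅ b = 0 := coeff_eq_zero_of_dual hθ hΔ fun v => by rw [← hΛ, hu]
  have hμΛ : ∀ J a b, μ J a b = koszulSign A a J * Λ (insert a J) b := by
    intro J a b
    refine sub_eq_zero.1 (coeff_eq_zero_of_dual hθ hΔ
      (μ := fun b => μ J a b - koszulSign A a J * Λ (insert a J) b) (fun v => ?_) b)
    simp_rw [sub_mul, Finset.sum_sub_distrib, mul_assoc]
    rw [← Finset.mul_sum, ← hμ, ← hΛ, sub_self]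
  have hmem : ∀ J, ∀ b ∈ J, Λ J b = 0 := by
    intro J b hb
    have h := hdiag (J.erase b) b
    rw [hμΛ, Finset.insert_erase hb] at h
    calc Λ J b = koszulSign A b (J.erase b) * koszulSign A b (J.erase b) * Λ J b := by
          rw [koszulSign_mul_self (Finset.notMem_erase b J), one_mul]
      _ = 0 := by rw [mul_assoc, h, mul_zero]
  -- The zero diagonal of μ gave Λ J b = 0 for b ∈ J; its antisymmetry together with the sign rule
  -- gives the compatibility of Λ.
  obtain ⟨c, hc⟩ := exists_koszulDel_eq (ℓ := ℓ) Λ hmem (by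
    intro J a b ha hb hab
    have h := hanti J a b
    rw [hμΛ, hμΛ] at h
    have e1 := koszulSign_mul_self (A := A) ha
    have e2 := koszulSign_mul_self (A := A) hb
    have e3 := koszulSign_insert_mul (A := A) hab J
    calc koszulSign A b (insert a J) * Λ (insert a J) b
        = koszulSign A b (insert a J) * koszulSign A a J *
            (koszulSign A a J * Λ (insert a J) b) := by
          linear_combination (-(koszulSign A b (insert a J) * Λ (insert a J) b)) * e1
      _ = koszulSign A a (insert b J) * Λ (insert b J) a := by
          rw [e3, h]
          linear_combination (koszulSign A a (insert b J) * Λ (insert b J) a) * e2)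
  refine ⟨c, ?_⟩
  ext v J
  rw [hc, hΛ]

/-- Every entry at a nonempty set occurs as a coefficient in some boundary entry, and these
coefficients are unique. The entry at ∅ never occurs and has to be assumed zero. -/
theorem koszulDel_injective
    (hθ : ∀ a b, ∑ v, θ b v * ℓ a v = if a = b then Δ else 0) (hΔ : Δ ≠ 0) {c : Finset ρ → A}
    (h0 : c ∅ = 0) (h : koszulDel ℓ c = 0) : c = 0 := by
  ext1 L
  rcases L.eq_empty_or_nonempty with rfl | ⟨a, ha⟩
  · exact h0
  · have := coeff_eq_zero_of_dual hθ hΔ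
      (μ := fun b => koszulSign A b (L.erase a) * c (insert b (L.erase a))) (fun v => by
        have := congrFun (congrFun h v) (L.erase a)
        rw [Pi.zero_apply, Pi.zero_apply] at this
        rw [← this]
        exact Finset.sum_congr rfl fun b _ => by ring) a
    rw [Finset.insert_erase ha] at this
    calc c L = koszulSign A a (L.erase a) * (koszulSign A a (L.erase a) * c L) := by
          rw [← mul_assoc, koszulSign_mul_self (Finset.notMem_erase a L), one_mul]
      _ = 0 := by rw [this, mul_zero]

end Koszul

/-! ### The graded pieces of the Koszul complex and the resulting Betti numbers. -/

section KoszulBetti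

variable {E ρ σ K : Type*} [Field K]

/-- Koszul chains of homological degree `i` and total degree `m`. -/
def koszulPiece (E ρ K : Type*) [Field K] (m i : ℕ) :
    Submodule K (Finset ρ → MvPolynomial E K) where
  carrier := {c | ∀ J s, coeff s (c J) ≠ 0 → J.card = i ∧ s.degree + i = m}
  zero_mem' := by simp
  add_mem' {c d} hc hd := by
    intro J s h
    by_contra h'
    have h1 := not_imp_comm.1 (hc J s) h'
    have h2 := not_imp_comm.1 (hd J s) h'
    simp [h1, h2] at h
  smul_mem' a c hc := by
    intro J s h
    refine hc J s fun h' => h ?_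
    simp [h']

theorem eq_zero_of_card_ne {m i : ℕ} {c : Finset ρ → MvPolynomial E K}
    (hc : c ∈ koszulPiece E ρ K m i) {J : Finset ρ} (hJ : J.card ≠ i) : c J = 0 := by
  ext s
  by_contra h
  exact hJ (hc J s h).1

theorem shiftComponent_eq_self {m i : ℕ} {c : Finset ρ → MvPolynomial E K}
    (hc : c ∈ koszulPiece E ρ K m i) (J : Finset ρ) : shiftComponent m i (c J) = c J := by
  classical
  ext s
  rw [coeff_shiftComponent]
  split_ifs with h
  · rfl
  · by_contra h'
    exact h (hc J s (Ne.symm h')).2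

/-- Projection to the chains of homological degree `i` and total degree `m`. -/
def koszulProj (m i : ℕ) (c : Finset ρ → MvPolynomial E K) : Finset ρ → MvPolynomial E K :=
  fun J => if J.card = i then shiftComponent m i (c J) else 0

theorem koszulProj_mem (m i : ℕ) (c : Finset ρ → MvPolynomial E K) :
    koszulProj m i c ∈ koszulPiece E ρ K m i := by
  classical
  intro J s h
  unfold koszulProj at h
  split_ifs at h with hJ
  · rw [coeff_shiftComponent] at h
    split_ifs at h with hs
    · exact ⟨hJ, hs⟩
    · exact absurd rfl h
  · simp at h

theorem koszulProj_eq_self {m i : ℕ} {c : Finset ρ → MvPolynomial E K}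
    (hc : c ∈ koszulPiece E ρ K m i) : koszulProj m i c = c := by
  ext1 J
  unfold koszulProj
  split_ifs with hJ
  · exact shiftComponent_eq_self hc J
  · exact (eq_zero_of_card_ne hc hJ).symm

/-- A basis is given by pairs of an i-element set and a monomial of degree m - i, counted by stars
and bars. -/
theorem finrank_koszulPiece [Fintype E] [Fintype ρ] (m i : ℕ) :
    Module.finrank K (koszulPiece E ρ K m i) =
      if i ≤ m then (Fintype.card E + (m - i) - 1).choose (m - i) * (Fintype.card ρ).choose i
      else 0 := by
  classical
  have hfin : {s : E →₀ ℕ | s.degree + i = m}.Finite :=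
    (Finsupp.finite_of_degree_le m).subset fun s hs => by
      simp only [Set.mem_ofPred_eq] at *
      omega
  let S := hfin.toFinset
  have hS : ∀ s, s ∈ S ↔ s.degree + i = m := by simp [S]
  let e : koszulPiece E ρ K m i ≃ₗ[K] ({J : Finset ρ // J.card = i} × S → K) :=
    { toFun := fun c p => coeff p.2.1 (c.1 p.1.1)
      map_add' := fun c d => by ext; simp
      map_smul' := fun a c => by ext; simp
      invFun := fun g => ⟨fun J => if h : J.card = i then ∑ s : S, monomial s.1 (g (⟨J, h⟩, s))
          else 0, by
        intro J s hs
        dsimp only at hs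
        split_ifs at hs with hJ
        · rw [coeff_sum] at hs
          obtain ⟨t, -, ht⟩ := Finset.exists_ne_zero_of_sum_ne_zero hs
          rw [coeff_monomial] at ht
          split_ifs at ht with hts
          · exact ⟨hJ, by rw [← hts]; exact (hS _).1 t.2⟩
          · exact absurd rfl ht
        · simp at hs⟩
      left_inv := fun c => by
        ext1
        funext J
        dsimp only
        split_ifs with hJ
        · ext s
          rw [coeff_sum]
          simp_rw [coeff_monomial]
          by_cases hs : s ∈ S
          · rw [Finset.sum_eq_single ⟨s, hs⟩]
            · simp
            · intro t _ ht
              exact if_neg fun h => ht (Subtype.ext h)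
            · simp
          · rw [Finset.sum_eq_zero]
            · by_contra h
              exact hs ((hS s).2 (c.2 J s (Ne.symm h)).2)
            · intro t _
              refine if_neg fun h => hs ?_
              rw [← h]
              exact t.2
        · exact (eq_zero_of_card_ne c.2 hJ).symm
      right_inv := fun g => by
        ext ⟨⟨J, hJ⟩, s⟩
        dsimp only
        rw [dif_pos hJ, coeff_sum]
        simp_rw [coeff_monomial]
        rw [Finset.sum_eq_single s]
        · simp
        · intro t _ ht
          exact if_neg fun h => ht (Subtype.ext h)
        · simp }
  rw [e.finrank_eq, Module.finrank_pi, Fintype.card_prod, Fintype.card_finset_len,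
    Fintype.card_coe, mul_comm]
  split_ifs with h
  · congr 1
    rw [← Finset.card_univ, ← Finset.card_finsuppAntidiag_nat_eq_choose]
    congr 1
    ext s
    rw [hS, Finset.mem_finsuppAntidiag, Finsupp.degree_eq_sum]
    simp only [Finset.subset_univ, and_true]
    change (∑ e, s e) + i = m ↔ (∑ e, s e) = m - i
    omega
  · rw [Finset.card_eq_zero.2, zero_mul]
    refine Finset.eq_empty_of_forall_notMem fun s hs => ?_
    rw [hS] at hs
    omega

variable [LinearOrder ρ]

theorem shiftComponent_sign_mul (m i : ℕ) (a : ρ) (J : Finset ρ) (p : MvPolynomial E K) :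
    shiftComponent m i (koszulSign _ a J * p) = koszulSign _ a J * shiftComponent m i p := by
  rcases koszulSign_cases (A := MvPolynomial E K) a J with h | h | h <;> simp [h]

variable [Fintype ρ]

/-- The Koszul differential as a linear map. -/
def koszulDelLinear (ℓ : ρ → σ → MvPolynomial E K) :
    (Finset ρ → MvPolynomial E K) →ₗ[K] (σ → Finset ρ → MvPolynomial E K) where
  toFun c := koszulDel ℓ c
  map_add' c d := by
    ext1 v
    ext1 J
    simp only [koszulDel, Pi.add_apply, mul_add, Finset.sum_add_distrib]
  map_smul' a c := by
    ext1 v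
    ext1 J
    simp only [koszulDel, Pi.smul_apply, RingHom.id_apply, mul_smul_comm, Finset.smul_sum]

theorem shiftComponent_koszulDel {ℓ : ρ → σ → MvPolynomial E K}
    (hℓ : ∀ a v, (ℓ a v).IsHomogeneous 1) (m i : ℕ) (c : Finset ρ → MvPolynomial E K) (v : σ)
    (J : Finset ρ) : shiftComponent m i (koszulDel ℓ c v J) =
      koszulDel ℓ (fun J => shiftComponent m (i + 1) (c J)) v J := by
  unfold koszulDel
  rw [map_sum]
  refine Finset.sum_congr rfl fun a _ => ?_
  rw [shiftComponent_sign_mul, shiftComponent_linear_mul (hℓ a v)]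

theorem koszulDel_koszulProj {ℓ : ρ → σ → MvPolynomial E K}
    (hℓ : ∀ a v, (ℓ a v).IsHomogeneous 1) (m i : ℕ) (c : Finset ρ → MvPolynomial E K) (v : σ) :
    koszulDel ℓ (koszulProj m (i + 1) c) v = koszulProj m i (koszulDel ℓ c v) := by
  ext1 J
  unfold koszulProj
  split_ifs with hJ
  · rw [shiftComponent_koszulDel hℓ]
    refine Finset.sum_congr rfl fun a _ => ?_
    by_cases ha : a ∈ J
    · rw [koszulSign_of_mem ha]
      ring
    · dsimp only
      rw [Finset.card_insert_of_notMem ha, hJ, if_pos rfl]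
  · refine Finset.sum_eq_zero fun a _ => ?_
    by_cases ha : a ∈ J
    · rw [koszulSign_of_mem ha]
      ring
    · dsimp only
      rw [Finset.card_insert_of_notMem ha, if_neg (by omega), mul_zero, mul_zero]

/-- Exactness can be proved without regard to degrees: projecting a preimage to the right degree
again gives a preimage. -/
theorem exists_koszulPiece_of_koszulDel_eq {ℓ : ρ → σ → MvPolynomial E K}
    (hℓ : ∀ a v, (ℓ a v).IsHomogeneous 1) {m i : ℕ} {u : σ → Finset ρ → MvPolynomial E K}
    (hu : ∀ v, u v ∈ koszulPiece E ρ K m i) {c : Finset ρ → MvPolynomial E K}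
    (hc : koszulDel ℓ c = u) : ∃ c ∈ koszulPiece E ρ K m (i + 1), koszulDel ℓ c = u := by
  refine ⟨koszulProj m (i + 1) c, koszulProj_mem _ _ _, ?_⟩
  ext1 v
  rw [koszulDel_koszulProj hℓ, hc, koszulProj_eq_self (hu v)]

variable [Fintype E] [Fintype σ]

/-- The linear strand of an ideal whose lowest degree part consists of the forms of degree `m` in
algebraically independent quadrics, whose first linear syzygies are generated by the linear
relations `ℓ`. -/
theorem betti_eq_of_linear_relations {ℓ : ρ → σ → MvPolynomial E K}
    (hℓ : ∀ a v, (ℓ a v).IsHomogeneous 1) {f : E → MvPolynomial σ K}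
    (hf : ∀ e, (f e).IsHomogeneous 2)
    (hinj : ∀ P : MvPolynomial E K, aeval f P = 0 → P = 0)
    (hsyz : ∀ p : σ → MvPolynomial E K,
      ∑ v, X v * aeval f (p v) = 0 ↔ ∃ μ : ρ → MvPolynomial E K, ∀ v, p v = ∑ a, μ a * ℓ a v)
    {θ : ρ → σ → MvPolynomial E K} {Δ : MvPolynomial E K}
    (hθ : ∀ a b, ∑ v, θ b v * ℓ a v = if a = b then Δ else 0) (hΔ : Δ ≠ 0)
    {I : Ideal (MvPolynomial σ K)} (F : MinimalGradedFreeResolution I) (m : ℕ)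
    (hlow : ∀ p ∈ I, ∀ k < 2 * m, homogeneousComponent k p = 0)
    (hI : ∀ P : MvPolynomial E K, P.IsHomogeneous m → aeval f P ∈ I)
    (hIsurj : ∀ p ∈ I, p.IsHomogeneous (2 * m) →
      ∃ P : MvPolynomial E K, P.IsHomogeneous m ∧ aeval f P = p) (i : ℕ) :
    F.betti i (2 * m + i) =
      if i ≤ m then (Fintype.card E + (m - i) - 1).choose (m - i) * (Fintype.card ρ).choose i
      else 0 := by
  classical
  let ε : (Finset ρ → MvPolynomial E K) →ₗ[K] MvPolynomial σ K :=
    (aeval f).toLinearMap ∘ₗ LinearMap.proj ∅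
  have hε : ∀ c, ε c = aeval f (c ∅) := fun c => rfl
  have hhom : ∀ c ∈ koszulPiece E ρ K m 0, (c ∅).IsHomogeneous m := by
    intro c hc s hs
    have := (hc ∅ s hs).2
    rwa [add_zero, Finsupp.degree_eq_weight_one] at this
  have hsup : ∀ {i : ℕ} {c : Finset ρ → MvPolynomial E K},
      c ∈ koszulPiece E ρ K m (i + 1) → c ∅ = 0 := fun hc =>
    eq_zero_of_card_ne hc (by simp)
  -- Saturation is automatic: membership in the relation module means vanishing after evaluation in
  -- a domain, and Δ evaluates to a nonzero element.
  have hsat : ∀ (p : σ → MvPolynomial E K) (μ : ρ → MvPolynomial E K),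
      (∀ v, Δ * p v = ∑ a, μ a * ℓ a v) →
      ∃ μ : ρ → MvPolynomial E K, ∀ v, p v = ∑ a, μ a * ℓ a v := by
    intro p μ h
    have h1 := (hsyz fun v => Δ * p v).2 ⟨μ, h⟩
    have h2 : aeval f Δ * ∑ v, X v * aeval f (p v) = 0 := by
      rw [← h1, Finset.mul_sum]
      refine Finset.sum_congr rfl fun v _ => ?_
      rw [map_mul]
      ring
    exact (hsyz p).1 ((mul_eq_zero.1 h2).resolve_left fun h => hΔ (hinj _ h))
  rw [← finrank_koszulPiece (K := K) m i]
  refine betti_eq_finrank F hlow (koszulPiece E ρ K m) (koszulDelLinear ℓ) ε ?_ ?_ ?_ ?_ ?_ ?_ ?_ i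
  · intro c hc
    have := (hhom c hc).aeval f hf
    rw [hε]
    exact ⟨hI _ (hhom c hc), this⟩
  · intro c hc h
    ext1 J
    rcases J.eq_empty_or_nonempty with rfl | hJ
    · exact hinj _ h
    · exact eq_zero_of_card_ne hc hJ.card_pos.ne'
  · intro p hp hpd
    obtain ⟨P, hP, rfl⟩ := hIsurj p hp hpd
    refine ⟨fun J => if J = ∅ then P else 0, ?_, by simp [hε]⟩
    intro J s hs
    dsimp only at hs
    split_ifs at hs with hJ
    · refine ⟨by simp [hJ], ?_⟩
      rw [add_zero, Finsupp.degree_eq_weight_one]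
      exact hP hs
    · simp at hs
  · intro i c hc v
    change koszulDel ℓ c v ∈ _
    rw [← koszulProj_eq_self hc, koszulDel_koszulProj hℓ]
    exact koszulProj_mem _ _ _
  · intro i c hc h
    exact koszulDel_injective hθ hΔ (hsup hc) h
  · intro u hu
    change _ ↔ ∃ w ∈ _, koszulDel ℓ w = u
    simp_rw [hε]
    rw [hsyz]
    constructor
    · rintro ⟨μ, hμ⟩
      -- In homological degree 0 only J = ∅ carries coefficients, so the compatibility condition is
      -- empty.
      obtain ⟨c, hc⟩ := exists_koszulDel_eq (ℓ := ℓ) (fun J b => if J = ∅ then μ b else 0)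
        (by
          intro J b hb
          rw [if_neg]
          rintro rfl
          simp at hb)
        (by simp)
      refine exists_koszulPiece_of_koszulDel_eq hℓ hu (c := c) ?_
      ext1 v
      ext1 J
      rw [hc]
      rcases J.eq_empty_or_nonempty with rfl | hJ
      · simp [hμ]
      · rw [eq_zero_of_card_ne (hu v) hJ.card_pos.ne']
        simp [hJ.ne_empty]
    · rintro ⟨c, -, rfl⟩
      refine ⟨fun a => koszulSign _ a ∅ * c (insert a ∅), fun v => ?_⟩
      exact Finset.sum_congr rfl fun a _ => by ring
  · intro i u hu
    change (((∀ v v', v ≠ v' → koszulDel ℓ (u v) v' + koszulDel ℓ (u v') v = 0) ∧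
      ∀ v, koszulDel ℓ (u v) v = 0) ↔ ∃ w ∈ _, koszulDel ℓ w = u)
    constructor
    · rintro ⟨h1, h2⟩
      obtain ⟨c, hc⟩ := exists_koszulDel_of_alternating hθ hΔ hsat u (fun v => hsup (hu v)) h1 h2
      exact exists_koszulPiece_of_koszulDel_eq hℓ hu hc
    · rintro ⟨c, -, rfl⟩
      exact koszulDel_alternating c

end KoszulBetti

/-! ### Leading exponents with respect to a weight -/

section Lead

variable {ι σ K : Type*} [Field K]

/-- `μ` is the unique exponent of maximal weight in `p`, and its coefficient is `1`. -/
def LeadAt (ω : σ → ℕ) (p : MvPolynomial σ K) (μ : σ →₀ ℕ) : Prop :=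
  coeff μ p = 1 ∧ ∀ ν, coeff ν p ≠ 0 → ν ≠ μ → Finsupp.weight ω ν < Finsupp.weight ω μ

variable {ω : σ → ℕ}

theorem LeadAt.weight_le {p : MvPolynomial σ K} {μ ν : σ →₀ ℕ} (h : LeadAt ω p μ)
    (hν : coeff ν p ≠ 0) : Finsupp.weight ω ν ≤ Finsupp.weight ω μ := by
  by_cases hn : ν = μ
  · rw [hn]
  · exact (h.2 ν hν hn).le

theorem leadAt_monomial (μ : σ →₀ ℕ) : LeadAt ω (monomial μ (1 : K)) μ := by
  classical
  refine ⟨by simp, fun ν h hν => ?_⟩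
  rw [coeff_monomial, if_neg hν.symm] at h
  exact absurd rfl h

theorem leadAt_one : LeadAt ω (1 : MvPolynomial σ K) 0 :=
  leadAt_monomial 0

/-- Weights add, so the maximal weight of a product is reached only by the product of the two
leading terms. -/
theorem LeadAt.mul {p q : MvPolynomial σ K} {μ ν : σ →₀ ℕ} (hp : LeadAt ω p μ)
    (hq : LeadAt ω q ν) : LeadAt ω (p * q) (μ + ν) := by
  classical
  constructor
  · rw [coeff_mul, Finset.sum_eq_single (μ, ν)]
    · rw [hp.1, hq.1, one_mul]
    · rintro ⟨a, b⟩ hab hne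
      rw [Finset.HasAntidiagonal.mem_antidiagonal] at hab
      dsimp only at hab ⊢
      by_contra h
      have ha := hp.weight_le (left_ne_zero_of_mul h)
      have hb := hq.weight_le (right_ne_zero_of_mul h)
      have hw := congrArg (Finsupp.weight ω) hab
      simp only [map_add] at hw
      have haμ : a = μ := by
        by_contra h'
        have := hp.2 a (left_ne_zero_of_mul h) h'
        omega
      have hbν : b = ν := by
        by_contra h'
        have := hq.2 b (right_ne_zero_of_mul h) h'
        omega
      exact hne (by rw [haμ, hbν])
    · intro h
      simp at h
  · intro s hs hne
    rw [coeff_mul] at hs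
    obtain ⟨⟨a, b⟩, hab, h⟩ := Finset.exists_ne_zero_of_sum_ne_zero hs
    rw [Finset.HasAntidiagonal.mem_antidiagonal] at hab
    dsimp only at hab h
    have ha := hp.weight_le (left_ne_zero_of_mul h)
    have hb := hq.weight_le (right_ne_zero_of_mul h)
    rw [← hab, map_add, map_add]
    by_cases haμ : a = μ
    · have hbν : b ≠ ν := by
        rintro rfl
        exact hne (by rw [← hab, haμ])
      have := hq.2 b (right_ne_zero_of_mul h) hbν
      omega
    · have := hp.2 a (left_ne_zero_of_mul h) haμ
      omega

theorem LeadAt.pow {p : MvPolynomial σ K} {μ : σ →₀ ℕ} (hp : LeadAt ω p μ) :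
    ∀ k, LeadAt ω (p ^ k) (k • μ)
  | 0 => by simpa using leadAt_one
  | k + 1 => by
    rw [pow_succ, succ_nsmul]
    exact (hp.pow k).mul hp

/-- Polynomials with distinct leading exponents are linearly independent. -/
theorem coeff_eq_zero_of_leadAt (T : Finset ι) {g : ι → MvPolynomial σ K} {μ : ι → σ →₀ ℕ}
    (hg : ∀ k ∈ T, LeadAt ω (g k) (μ k)) (hμ : ∀ k ∈ T, ∀ l ∈ T, μ k = μ l → k = l) {c : ι → K}
    (h : ∑ k ∈ T, C (c k) * g k = 0) : ∀ k ∈ T, c k = 0 := by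
  classical
  by_contra! hc
  obtain ⟨k, hk, hck⟩ := hc
  obtain ⟨l, hl, hmax⟩ := (T.filter fun k => c k ≠ 0).exists_max_image
    (fun k => Finsupp.weight ω (μ k)) ⟨k, Finset.mem_filter.2 ⟨hk, hck⟩⟩
  rw [Finset.mem_filter] at hl
  have h1 := congrArg (coeff (μ l)) h
  rw [coeff_sum, Finset.sum_eq_single l] at h1
  · rw [coeff_C_mul, (hg l hl.1).1, mul_one] at h1
    exact hl.2 (by simpa using h1)
  · intro k hk hkl
    rw [coeff_C_mul]
    by_contra h'
    have h2 := (hg k hk).2 _ (right_ne_zero_of_mul h') (fun e => hkl (hμ k hk l hl.1 e.symm))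
    have h3 := hmax k (Finset.mem_filter.2 ⟨hk, left_ne_zero_of_mul h'⟩)
    omega
  · exact fun h => absurd hl.1 h

end Lead

/-! ### Edges and triangles of a graph with ordered vertices -/

section Graph

variable {n : ℕ}

/-- An edge `{fst, snd}` with `fst < snd`. -/
@[ext]
structure OrdEdge (H : SimpleGraph (Fin n)) where
  /-- the smaller endpoint -/
  fst : Fin n
  /-- the larger endpoint -/
  snd : Fin n
  /-- the endpoints are ordered -/
  lt : fst < snd
  /-- the endpoints are adjacent -/
  adj : H.Adj fst snd

/-- A triangle `{fst, mid, lst}` with `fst < mid < lst`. -/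
@[ext]
structure OrdTriangle (H : SimpleGraph (Fin n)) where
  /-- the smallest vertex -/
  fst : Fin n
  /-- the middle vertex -/
  mid : Fin n
  /-- the largest vertex -/
  lst : Fin n
  /-- the vertices are ordered -/
  lt₁ : fst < mid
  /-- the vertices are ordered -/
  lt₂ : mid < lst
  /-- the vertices are adjacent -/
  adj₁ : H.Adj fst mid
  /-- the vertices are adjacent -/
  adj₂ : H.Adj fst lst
  /-- the vertices are adjacent -/
  adj₃ : H.Adj mid lst

variable {H : SimpleGraph (Fin n)}

instance : Finite (OrdEdge H) :=
  Finite.of_injective (fun e : OrdEdge H => (e.fst, e.snd)) fun e e' h => by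
    simp only [Prod.mk.injEq] at h
    exact OrdEdge.ext h.1 h.2

instance : Finite (OrdTriangle H) :=
  Finite.of_injective (fun e : OrdTriangle H => (e.fst, e.mid, e.lst)) fun e e' h => by
    simp only [Prod.mk.injEq] at h
    exact OrdTriangle.ext h.1 h.2.1 h.2.2

instance : Fintype (OrdEdge H) := Fintype.ofFinite _

instance : Fintype (OrdTriangle H) := Fintype.ofFinite _

namespace OrdTriangle

/-- The edge joining the smallest and the middle vertex. -/
def e₁ (T : OrdTriangle H) : OrdEdge H := ⟨T.fst, T.mid, T.lt₁, T.adj₁⟩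

/-- The edge joining the smallest and the largest vertex. -/
def e₂ (T : OrdTriangle H) : OrdEdge H := ⟨T.fst, T.lst, T.lt₁.trans T.lt₂, T.adj₂⟩

/-- The edge joining the middle and the largest vertex. -/
def e₃ (T : OrdTriangle H) : OrdEdge H := ⟨T.mid, T.lst, T.lt₂, T.adj₃⟩

end OrdTriangle

theorem card_ordEdge (H : SimpleGraph (Fin n)) :
    Fintype.card (OrdEdge H) = H.edgeSet.ncard := by
  rw [← Nat.card_eq_fintype_card, ← Nat.card_coe_set_eq]
  refine Nat.card_congr (Equiv.ofBijective
    (fun e : OrdEdge H => (⟨s(e.fst, e.snd), e.adj⟩ : H.edgeSet)) ⟨fun e e' h => ?_, ?_⟩)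
  · have h1 : s(e.fst, e.snd) = s(e'.fst, e'.snd) := congrArg Subtype.val h
    rw [Sym2.eq_iff] at h1
    rcases h1 with h1 | h1
    · exact OrdEdge.ext h1.1 h1.2
    · have h2 := e.lt
      rw [h1.1, h1.2] at h2
      exact absurd e'.lt h2.not_gt
  · rintro ⟨s, hs⟩
    induction s using Sym2.ind with
    | _ a b =>
      have hab : H.Adj a b := hs
      rcases hab.ne.lt_or_gt with h | h
      · exact ⟨⟨a, b, h, hab⟩, rfl⟩
      · exact ⟨⟨b, a, h, hab.symm⟩, Subtype.ext Sym2.eq_swap⟩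

theorem card_ordTriangle (H : SimpleGraph (Fin n)) :
    Fintype.card (OrdTriangle H) = (H.cliqueSet 3).ncard := by
  classical
  rw [← Nat.card_eq_fintype_card, ← Nat.card_coe_set_eq]
  refine Nat.card_congr (Equiv.ofBijective
    (fun T : OrdTriangle H => (⟨{T.fst, T.mid, T.lst}, by
      rw [SimpleGraph.mem_cliqueSet_iff, SimpleGraph.is3Clique_triple_iff]
      exact ⟨T.adj₁, T.adj₂, T.adj₃⟩⟩ : H.cliqueSet 3)) ⟨fun T T' h => ?_, ?_⟩)
  · have h1 : ({T.fst, T.mid, T.lst} : Finset (Fin n)) = {T'.fst, T'.mid, T'.lst} :=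
      congrArg Subtype.val h
    have l1 := T.lt₁
    have l2 := T.lt₂
    have l3 := T'.lt₁
    have l4 := T'.lt₂
    have m1 : T.fst ∈ ({T'.fst, T'.mid, T'.lst} : Finset (Fin n)) := by simp [← h1]
    have m2 : T.mid ∈ ({T'.fst, T'.mid, T'.lst} : Finset (Fin n)) := by simp [← h1]
    have m3 : T.lst ∈ ({T'.fst, T'.mid, T'.lst} : Finset (Fin n)) := by simp [← h1]
    simp only [Finset.mem_insert, Finset.mem_singleton] at m1 m2 m3
    apply OrdTriangle.ext <;> omega
  · rintro ⟨s, hs⟩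
    rw [SimpleGraph.mem_cliqueSet_iff, SimpleGraph.is3Clique_iff] at hs
    obtain ⟨a, b, c, hab, hac, hbc, rfl⟩ := hs
    have h1 := hab.ne
    have h2 := hac.ne
    have h3 := hbc.ne
    have key : ∀ T : OrdTriangle H, ({T.fst, T.mid, T.lst} : Finset (Fin n)) = {a, b, c} →
        ∃ T : OrdTriangle H, (⟨{T.fst, T.mid, T.lst}, by
          rw [SimpleGraph.mem_cliqueSet_iff, SimpleGraph.is3Clique_triple_iff]
          exact ⟨T.adj₁, T.adj₂, T.adj₃⟩⟩ : H.cliqueSet 3) = ⟨{a, b, c}, by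
            rw [SimpleGraph.mem_cliqueSet_iff, SimpleGraph.is3Clique_triple_iff]
            exact ⟨hab, hac, hbc⟩⟩ := fun T hT => ⟨T, Subtype.ext hT⟩
    rcases h1.lt_or_gt with l1 | l1 <;> rcases h2.lt_or_gt with l2 | l2 <;>
      rcases h3.lt_or_gt with l3 | l3
    · exact key ⟨a, b, c, l1, l3, hab, hac, hbc⟩ rfl
    · exact key ⟨a, c, b, l2, l3, hac, hab, hbc.symm⟩ (by ext; simp; tauto)
    · omega
    · exact key ⟨c, a, b, l2, l1, hac.symm, hbc.symm, hab⟩ (by ext; simp; tauto)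
    · exact key ⟨b, a, c, l1, l2, hab.symm, hbc, hac⟩ (by ext; simp; tauto)
    · omega
    · exact key ⟨b, c, a, l3, l2, hbc, hab.symm, hac.symm⟩ (by ext; simp; tauto)
    · exact key ⟨c, b, a, l3, l1, hbc.symm, hac.symm, hab.symm⟩ (by ext; simp; tauto)

/-! ### Neighbourhoods in a closed labeling without K_4. -/

theorem not_adj_of_cliqueFree_four (hK : H.CliqueFree 4) {a b c d : Fin n} (hab : H.Adj a b)
    (hac : H.Adj a c) (had : H.Adj a d) (hbc : H.Adj b c) (hbd : H.Adj b d) : ¬ H.Adj c d := by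
  classical
  intro hcd
  refine hK {a, b, c, d} ?_
  rw [SimpleGraph.isNClique_iff, SimpleGraph.isClique_iff]
  constructor
  · simp [Set.pairwise_insert, hab, hac, had, hbc, hbd, hcd, hab.symm, hac.symm, had.symm,
      hbc.symm, hbd.symm, hcd.symm]
  · simp [hab.ne, hac.ne, had.ne, hbc.ne, hbd.ne, hcd.ne]

/-- Closedness makes the larger neighbours of a vertex pairwise adjacent, so three of them would
complete a K_4. -/
theorem upper_neighbours (hH : IsClosedLabeled H) (hK : H.CliqueFree 4) {i a b c : Fin n}
    (ha : i < a) (hb : i < b) (hc : i < c) (hia : H.Adj i a) (hib : H.Adj i b) (hic : H.Adj i c)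
    (hab : a ≠ b) (hac : a ≠ c) : b = c := by
  by_contra hbc
  exact not_adj_of_cliqueFree_four hK hia hib hic (hH.1 _ _ _ ha hb hab hia hib)
    (hH.1 _ _ _ ha hc hac hia hic) (hH.1 _ _ _ hb hc hbc hib hic)

theorem lower_neighbours (hH : IsClosedLabeled H) (hK : H.CliqueFree 4) {i a b c : Fin n}
    (ha : a < i) (hb : b < i) (hc : c < i) (hia : H.Adj a i) (hib : H.Adj b i) (hic : H.Adj c i)
    (hab : a ≠ b) (hac : a ≠ c) : b = c := by
  by_contra hbc
  exact not_adj_of_cliqueFree_four hK hia.symm hib.symm hic.symm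
    (hH.2 _ _ _ ha hb hab hia hib) (hH.2 _ _ _ ha hc hac hia hic) (hH.2 _ _ _ hb hc hbc hib hic)

theorem OrdTriangle.eq_of_fst_eq (hH : IsClosedLabeled H) (hK : H.CliqueFree 4)
    {T T' : OrdTriangle H} (h : T.fst = T'.fst) : T = T' := by
  obtain ⟨i, j, k, hij, hjk, a1, a2, a3⟩ := T
  obtain ⟨i', j', k', hij', hjk', a1', a2', a3'⟩ := T'
  dsimp only at h
  subst h
  have key := fun {a b c : Fin n} => upper_neighbours (i := i) (a := a) (b := b) (c := c) hH hK
  have h1 : j' = j ∨ j' = k := by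
    by_contra! hc
    exact hjk.ne (key hij' hij (hij.trans hjk) a1' a1 a2 hc.1 hc.2)
  have h2 : k' = j ∨ k' = k := by
    by_contra! hc
    exact hjk.ne (key (hij'.trans hjk') hij (hij.trans hjk) a2' a1 a2 hc.1 hc.2)
  have h3 : j' = j := by omega
  have h4 : k' = k := by omega
  subst h3 h4
  rfl

theorem OrdTriangle.eq_of_lst_eq (hH : IsClosedLabeled H) (hK : H.CliqueFree 4)
    {T T' : OrdTriangle H} (h : T.lst = T'.lst) : T = T' := by
  obtain ⟨i, j, k, hij, hjk, a1, a2, a3⟩ := T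
  obtain ⟨i', j', k', hij', hjk', a1', a2', a3'⟩ := T'
  dsimp only at h
  subst h
  have key := fun {a b c : Fin n} => lower_neighbours (i := k) (a := a) (b := b) (c := c) hH hK
  have h1 : j' = j ∨ j' = i := by
    by_contra! hc
    exact hij.ne' (key hjk' hjk (hij.trans hjk) a3' a3 a2 hc.1 hc.2)
  have h2 : i' = j ∨ i' = i := by
    by_contra! hc
    exact hij.ne' (key (hij'.trans hjk') hjk (hij.trans hjk) a2' a3 a2 hc.1 hc.2)
  have h3 : j' = j := by omega
  have h4 : i' = i := by omega
  subst h3 h4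
  rfl

/-! ### The toric relations of the initial monomials -/

/-- The exponent of the initial monomial `xᵢ yⱼ` of an edge. -/
def leadEdge (e : OrdEdge H) : Fin n ⊕ Fin n →₀ ℕ :=
  Finsupp.single (Sum.inl e.fst) 1 + Finsupp.single (Sum.inr e.snd) 1

/-- The exponent of a product of initial monomials. -/
def leadExp (α : OrdEdge H →₀ ℕ) : Fin n ⊕ Fin n →₀ ℕ := ∑ e, α e • leadEdge e

theorem leadExp_add (α β : OrdEdge H →₀ ℕ) : leadExp (α + β) = leadExp α + leadExp β := by
  simp [leadExp, add_smul, Finset.sum_add_distrib]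

theorem leadExp_single (e : OrdEdge H) (k : ℕ) :
    leadExp (Finsupp.single e k) = k • leadEdge e := by
  classical
  rw [leadExp, Finset.sum_eq_single e]
  · simp
  · intro b _ hb
    rw [Finsupp.single_eq_of_ne hb, zero_smul]
  · simp

theorem leadExp_inl (α : OrdEdge H →₀ ℕ) (i : Fin n) :
    leadExp α (Sum.inl i) = ∑ e, if e.fst = i then α e else 0 := by
  classical
  simp [leadExp, leadEdge, Finsupp.finsetSum_apply, Finsupp.single_apply]

theorem leadExp_inr (α : OrdEdge H →₀ ℕ) (j : Fin n) :
    leadExp α (Sum.inr j) = ∑ e, if e.snd = j then α e else 0 := by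
  classical
  simp [leadExp, leadEdge, Finsupp.finsetSum_apply, Finsupp.single_apply]

/-- The product of the variable `v` with the edge monomial `α` is divisible by the leading term of
one of the linear relations. -/
def Reducible (v : Fin n ⊕ Fin n) (α : OrdEdge H →₀ ℕ) : Prop :=
  ∃ T : OrdTriangle H, (v = Sum.inr T.lst ∧ α T.e₁ ≠ 0) ∨ (v = Sum.inl T.mid ∧ α T.e₂ ≠ 0)

theorem sum_ite_lt_of_forall_le {P : OrdEdge H → Prop} [DecidablePred P] {α α' : OrdEdge H →₀ ℕ}
    {h : OrdEdge H} (hP : P h) (hlt : α' h < α h) (hle : ∀ e, P e → α' e ≤ α e) :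
    ∑ e, (if P e then α' e else 0) < ∑ e, if P e then α e else 0 := by
  refine Finset.sum_lt_sum (fun e _ => ?_) ⟨h, Finset.mem_univ h, by simpa [hP] using hlt⟩
  split_ifs with he
  · exact hle e he
  · exact le_rfl

/-- Let h be the lexicographically last edge where the two products differ. The K_4-free closed
structure ensures that every other edge sharing one particular endpoint with h comes after h; α
therefore has the larger exponent at that variable r, and δ' must make up for it. At the other
endpoint q, unless δ' compensates, α' must contain an earlier edge e through that endpoint; e and h
span a triangle, which makes r and α' reducible. -/
theorem exists_reducible_of_lt (hH : IsClosedLabeled H) (hK : H.CliqueFree 4)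
    {δ δ' : Fin n ⊕ Fin n →₀ ℕ} {α α' : OrdEdge H →₀ ℕ} (heq : δ + leadExp α = δ' + leadExp α')
    {h : OrdEdge H}
    (hmax : ∀ e, toLex (h.fst, h.snd) < toLex (e.fst, e.snd) → α e = α' e) (hlt : α' h < α h) :
    ∃ r q, r ≠ q ∧ δ r < δ' r ∧ (δ' q ≤ δ q → Reducible r α') := by
  classical
  have hinl : ∀ i, δ (Sum.inl i) + (∑ e, if e.fst = i then α e else 0) =
      δ' (Sum.inl i) + ∑ e, if e.fst = i then α' e else 0 := fun i => by
    simpa [leadExp_inl] using DFunLike.congr_fun heq (Sum.inl i)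
  have hinr : ∀ j, δ (Sum.inr j) + (∑ e, if e.snd = j then α e else 0) =
      δ' (Sum.inr j) + ∑ e, if e.snd = j then α' e else 0 := fun j => by
    simpa [leadExp_inr] using DFunLike.congr_fun heq (Sum.inr j)
  simp only [Prod.Lex.toLex_lt_toLex] at hmax
  -- If h.fst has a neighbour k strictly inside h, then r = y at h.snd: an edge into h.snd from
  -- below h.fst would give a K_4 with k. Otherwise r = x at h.fst, since h is the shortest edge
  -- going up from there.
  by_cases hk : ∃ k, h.fst < k ∧ k < h.snd ∧ H.Adj h.fst k
  · obtain ⟨k, hk1, hk2, hk3⟩ := hk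
    have hkj : H.Adj k h.snd := hH.1 _ _ _ hk1 h.lt hk2.ne hk3 h.adj
    refine ⟨Sum.inr h.snd, Sum.inl h.fst, by simp, ?_, fun hq => ?_⟩
    · have := sum_ite_lt_of_forall_le (P := fun e : OrdEdge H => e.snd = h.snd) rfl hlt
        fun e he => by
          by_cases heh : e = h
          · rw [heh]; exact hlt.le
          refine (hmax e (Or.inl ?_)).ge
          have hne : e.fst ≠ h.fst := fun h' => heh (OrdEdge.ext h' he)
          by_contra hle
          have hlt' : e.fst < h.fst := lt_of_le_of_ne (not_lt.1 hle) hne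
          have ha : H.Adj e.fst h.snd := he ▸ e.adj
          exact not_adj_of_cliqueFree_four hK (hH.2 _ _ _ (hlt'.trans h.lt) h.lt hne ha h.adj)
            (hH.2 _ _ _ (hlt'.trans h.lt) hk2 (hlt'.trans hk1).ne ha hkj) ha hk3 h.adj hkj
      have := hinr h.snd
      omega
    · have hex : ∃ e : OrdEdge H, e.fst = h.fst ∧ α e < α' e := by
        by_contra! hc
        have := sum_ite_lt_of_forall_le (P := fun e : OrdEdge H => e.fst = h.fst) rfl hlt hc
        have := hinl h.fst
        omega
      obtain ⟨e, he, hlt'⟩ := hex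
      have hes : e.snd < h.snd := by
        by_contra hc
        rcases (not_lt.1 hc).lt_or_eq with hc | hc
        · have := hmax e (Or.inr ⟨he.symm, hc⟩)
          omega
        · rw [OrdEdge.ext he hc.symm] at hlt'
          omega
      have hie : h.fst < e.snd := he ▸ e.lt
      have hae : H.Adj h.fst e.snd := he ▸ e.adj
      refine ⟨⟨h.fst, e.snd, h.snd, hie, hes, hae, h.adj,
        hH.1 _ _ _ hie h.lt hes.ne hae h.adj⟩, Or.inl ⟨rfl, ?_⟩⟩
      rw [OrdTriangle.e₁, show (⟨h.fst, e.snd, hie, hae⟩ : OrdEdge H) = e from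
        OrdEdge.ext he.symm rfl]
      omega
  · push Not at hk
    refine ⟨Sum.inl h.fst, Sum.inr h.snd, by simp, ?_, fun hq => ?_⟩
    · have := sum_ite_lt_of_forall_le (P := fun e : OrdEdge H => e.fst = h.fst) rfl hlt
        fun e he => by
          by_cases heh : e = h
          · rw [heh]; exact hlt.le
          refine (hmax e (Or.inr ⟨he.symm, ?_⟩)).ge
          have hne : e.snd ≠ h.snd := fun h' => heh (OrdEdge.ext he h')
          by_contra hle
          have hlt' : e.snd < h.snd := lt_of_le_of_ne (not_lt.1 hle) hne
          exact hk e.snd (he ▸ e.lt) hlt' (he ▸ e.adj)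
      have := hinl h.fst
      omega
    · have hex : ∃ e : OrdEdge H, e.snd = h.snd ∧ α e < α' e := by
        by_contra! hc
        have := sum_ite_lt_of_forall_le (P := fun e : OrdEdge H => e.snd = h.snd) rfl hlt hc
        have := hinr h.snd
        omega
      obtain ⟨e, he, hlt'⟩ := hex
      have hes : e.fst < h.fst := by
        by_contra hc
        rcases (not_lt.1 hc).lt_or_eq with hc | hc
        · have := hmax e (Or.inl hc)
          omega
        · rw [OrdEdge.ext hc.symm he] at hlt'
          omega
      have hej : e.fst < h.snd := he ▸ e.lt
      have hae : H.Adj e.fst h.snd := he ▸ e.adj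
      refine ⟨⟨e.fst, h.fst, h.snd, hes, h.lt, hH.2 _ _ _ hej h.lt hes.ne hae h.adj, hae,
        h.adj⟩, Or.inr ⟨rfl, ?_⟩⟩
      rw [OrdTriangle.e₂]
      rw [show (⟨e.fst, h.snd, hes.trans h.lt, hae⟩ : OrdEdge H) = e from
        OrdEdge.ext rfl he.symm]
      omega

theorem exists_max_ne {α α' : OrdEdge H →₀ ℕ} (hne : α ≠ α') :
    ∃ h : OrdEdge H, α h ≠ α' h ∧
      ∀ e, toLex (h.fst, h.snd) < toLex (e.fst, e.snd) → α e = α' e := by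
  classical
  obtain ⟨e, he⟩ := DFunLike.ne_iff.1 hne
  obtain ⟨h, hh, hmax⟩ := (Finset.univ.filter fun e => α e ≠ α' e).exists_max_image
    (fun e => toLex (e.fst, e.snd)) ⟨e, by simpa using he⟩
  refine ⟨h, by simpa using hh, fun e' he' => ?_⟩
  by_contra hc
  exact absurd (hmax e' (by simpa using hc)) (not_le.2 he')

/-- Without extra factors δ, δ' there is nothing to make up for the difference. -/
theorem leadExp_injective (hH : IsClosedLabeled H) (hK : H.CliqueFree 4) :
    Function.Injective (leadExp : (OrdEdge H →₀ ℕ) → _) := by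
  intro α α' heq
  by_contra hne
  obtain ⟨h, hh, hmax⟩ := exists_max_ne hne
  rcases hh.lt_or_gt with hlt | hlt
  · obtain ⟨r, -, -, hr, -⟩ := exists_reducible_of_lt (δ := 0) (δ' := 0) hH hK
      (by rw [heq]) (fun e he => (hmax e he).symm) hlt
    simp at hr
  · obtain ⟨r, -, -, hr, -⟩ := exists_reducible_of_lt (δ := 0) (δ' := 0) hH hK
      (by rw [heq]) hmax hlt
    simp at hr

theorem reducible_of_single_add_leadExp_eq (hH : IsClosedLabeled H) (hK : H.CliqueFree 4)
    {v v' : Fin n ⊕ Fin n} {α α' : OrdEdge H →₀ ℕ}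
    (heq : Finsupp.single v 1 + leadExp α = Finsupp.single v' 1 + leadExp α')
    {h : OrdEdge H}
    (hmax : ∀ e, toLex (h.fst, h.snd) < toLex (e.fst, e.snd) → α e = α' e) (hlt : α' h < α h) :
    Reducible v' α' := by
  classical
  obtain ⟨r, q, hrq, hr, hq⟩ := exists_reducible_of_lt hH hK heq hmax hlt
  have hv : v' = r := by
    by_contra hc
    rw [Finsupp.single_eq_of_ne (Ne.symm hc)] at hr
    omega
  rw [hv]
  refine hq ?_
  rw [hv, Finsupp.single_eq_of_ne hrq.symm]
  exact Nat.zero_le _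

/-- Uniqueness of normal forms: among products of one variable with edge monomials, the irreducible
ones have distinct exponents. -/
theorem single_add_leadExp_injective (hH : IsClosedLabeled H) (hK : H.CliqueFree 4)
    {v v' : Fin n ⊕ Fin n} {α α' : OrdEdge H →₀ ℕ}
    (heq : Finsupp.single v 1 + leadExp α = Finsupp.single v' 1 + leadExp α')
    (h : ¬ Reducible v α) (h' : ¬ Reducible v' α') : v = v' ∧ α = α' := by
  have hα : α = α' := by
    by_contra hne
    obtain ⟨e, he, hmax⟩ := exists_max_ne hne
    rcases he.lt_or_gt with hlt | hlt
    · exact h (reducible_of_single_add_leadExp_eq hH hK heq.symm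
        (fun e he => (hmax e he).symm) hlt)
    · exact h' (reducible_of_single_add_leadExp_eq hH hK heq hmax hlt)
  subst hα
  exact ⟨Finsupp.single_left_injective one_ne_zero (add_right_cancel heq), rfl⟩

end Graph

/-! ### Linear relations between the edge binomials -/

section Relations

variable {n : ℕ} {K : Type*} [Field K] {H : SimpleGraph (Fin n)}

/-- The binomial `xᵢ yⱼ - κ xⱼ yᵢ` of an edge `i < j`: the generator of the binomial edge ideal for
`κ = 1`, and its initial monomial for `κ = 0`. -/
def edgeQuadric (κ : K) (e : OrdEdge H) : MvPolynomial (Fin n ⊕ Fin n) K :=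
  X (Sum.inl e.fst) * X (Sum.inr e.snd) - C κ * (X (Sum.inl e.snd) * X (Sum.inr e.fst))

theorem isHomogeneous_edgeQuadric (κ : K) (e : OrdEdge H) : (edgeQuadric κ e).IsHomogeneous 2 :=
  ((isHomogeneous_X K _).mul (isHomogeneous_X K _)).sub
    (((isHomogeneous_X K _).mul (isHomogeneous_X K _)).C_mul κ)

/-- The weight selecting the initial monomials of the edge binomials. -/
def edgeWeight : Fin n ⊕ Fin n → ℕ := Sum.elim 0 fun j => j

theorem leadAt_edgeQuadric (κ : K) (e : OrdEdge H) :
    LeadAt edgeWeight (edgeQuadric κ e) (leadEdge e) := by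
  classical
  have h1 : edgeQuadric κ e = monomial (leadEdge e) 1 - monomial
      (Finsupp.single (Sum.inl e.snd) 1 + Finsupp.single (Sum.inr e.fst) 1) κ := by
    rw [edgeQuadric, leadEdge, X, X, X, X, monomial_mul, monomial_mul, C_mul_monomial]
    simp
  have h2 : Finsupp.weight edgeWeight (leadEdge e) = (e.snd : ℕ) := by
    simp [leadEdge, edgeWeight, Finsupp.weight_single]
  have h3 : Finsupp.weight edgeWeight
      (Finsupp.single (Sum.inl e.snd) 1 + Finsupp.single (Sum.inr e.fst) 1) = (e.fst : ℕ) := by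
    simp [edgeWeight, Finsupp.weight_single]
  have hlt : (e.fst : ℕ) < e.snd := e.lt
  rw [h1]
  constructor
  · rw [coeff_sub, coeff_monomial, coeff_monomial, if_pos rfl, if_neg, sub_zero]
    intro h
    rw [h, h2] at h3
    omega
  · intro ν hν hne
    rw [coeff_sub, coeff_monomial, coeff_monomial, if_neg hne.symm] at hν
    split_ifs at hν with h
    · rw [← h, h2, h3]
      exact hlt
    · simp at hν

theorem leadAt_aeval_monomial (κ : K) (α : OrdEdge H →₀ ℕ) :
    LeadAt edgeWeight (aeval (edgeQuadric κ) (monomial α (1 : K))) (leadExp α) := by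
  induction α using Finsupp.induction_linear with
  | zero => simpa [leadExp] using leadAt_one
  | add α β hα hβ =>
    have h : (monomial (α + β) (1 : K)) = monomial α 1 * monomial β 1 := by
      rw [monomial_mul, one_mul]
    rw [h, map_mul, leadExp_add]
    exact hα.mul hβ
  | single e k =>
    have : aeval (edgeQuadric κ) (monomial (Finsupp.single e k) (1 : K)) =
        edgeQuadric κ e ^ k := by
      rw [aeval_monomial]
      simp
    rw [this, leadExp_single]
    exact (leadAt_edgeQuadric κ e).pow k

theorem aeval_eq_sum_support {E σ : Type*} (f : E → MvPolynomial σ K) (P : MvPolynomial E K) :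
    aeval f P = ∑ α ∈ P.support, C (coeff α P) * aeval f (monomial α (1 : K)) := by
  conv_lhs => rw [← support_sum_monomial_coeff P, map_sum]
  refine Finset.sum_congr rfl fun α _ => ?_
  rw [← mul_one (coeff α P), ← smul_eq_mul, ← smul_monomial, map_smul, smul_eq_C_mul]
  simp

/-- The edge binomials are algebraically independent. -/
theorem aeval_edgeQuadric_injective (hH : IsClosedLabeled H) (hK : H.CliqueFree 4) (κ : K)
    (P : MvPolynomial (OrdEdge H) K) (h : aeval (edgeQuadric κ) P = 0) : P = 0 := by
  rw [aeval_eq_sum_support] at h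
  have := coeff_eq_zero_of_leadAt P.support (fun α _ => leadAt_aeval_monomial κ α)
    (fun α _ β _ hαβ => leadExp_injective hH hK hαβ) h
  ext α
  by_contra hα
  exact hα (this α (mem_support_iff.2 hα))

/-- Evaluation of linear forms in the variables with coefficients in the polynomial ring of the
edges. -/
def linearEval {E σ : Type*} [Fintype σ] (f : E → MvPolynomial σ K) :
    (σ → MvPolynomial E K) →ₗ[K] MvPolynomial σ K :=
  ∑ v, (LinearMap.mulLeft K (X v)) ∘ₗ (aeval f).toLinearMap ∘ₗ LinearMap.proj v

theorem linearEval_apply {E σ : Type*} [Fintype σ] (f : E → MvPolynomial σ K)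
    (p : σ → MvPolynomial E K) : linearEval f p = ∑ v, X v * aeval f (p v) := by
  simp [linearEval, LinearMap.sum_apply]

theorem linearEval_single {E σ : Type*} [Fintype σ] [DecidableEq σ] (f : E → MvPolynomial σ K)
    (v : σ) (P : MvPolynomial E K) : linearEval f (Pi.single v P) = X v * aeval f P := by
  rw [linearEval_apply, Finset.sum_eq_single v]
  · simp
  · intro w _ hw
    simp [hw]
  · simp

theorem linearEval_smul {E σ : Type*} [Fintype σ] (f : E → MvPolynomial σ K)
    (P : MvPolynomial E K) (p : σ → MvPolynomial E K) :
    linearEval f (P • p) = aeval f P * linearEval f p := by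
  rw [linearEval_apply, linearEval_apply, Finset.mul_sum]
  refine Finset.sum_congr rfl fun v _ => ?_
  rw [Pi.smul_apply, smul_eq_mul, map_mul]
  ring

/-- The two linear relations of a triangle `i < j < k`. -/
def triangleRelation (κ : K) :
    OrdTriangle H ⊕ OrdTriangle H → Fin n ⊕ Fin n → MvPolynomial (OrdEdge H) K
  | Sum.inl T => Pi.single (Sum.inr T.lst) (X T.e₁) - Pi.single (Sum.inr T.mid) (X T.e₂) +
      Pi.single (Sum.inr T.fst) (C κ * X T.e₃)
  | Sum.inr T => Pi.single (Sum.inl T.mid) (X T.e₂) - Pi.single (Sum.inl T.fst) (X T.e₃) -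
      Pi.single (Sum.inl T.lst) (C κ * X T.e₁)

theorem isHomogeneous_single {σ E : Type*} [DecidableEq σ] {P : MvPolynomial E K} {d : ℕ}
    (hP : P.IsHomogeneous d) (v w : σ) :
    ((Pi.single v P : σ → MvPolynomial E K) w).IsHomogeneous d := by
  by_cases h : w = v
  · subst h; simpa using hP
  · simpa [h] using isHomogeneous_zero E K d

theorem isHomogeneous_triangleRelation (κ : K) (a : OrdTriangle H ⊕ OrdTriangle H)
    (v : Fin n ⊕ Fin n) : (triangleRelation κ a v).IsHomogeneous 1 := by
  have hX := fun e : OrdEdge H => isHomogeneous_X K e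
  rcases a with T | T
  · exact ((isHomogeneous_single (hX _) _ _).sub (isHomogeneous_single (hX _) _ _)).add
      (isHomogeneous_single ((hX _).C_mul κ) _ _)
  · exact ((isHomogeneous_single (hX _) _ _).sub (isHomogeneous_single (hX _) _ _)).sub
      (isHomogeneous_single ((hX _).C_mul κ) _ _)

/-- For κ = 1 these are the two expansions of a vanishing 3 × 3 determinant with a repeated row of
y's or x's; for κ = 0 they are equalities of two monomials. The general case differs by a multiple
of κ² - κ. -/
theorem linearEval_triangleRelation {κ : K} (hκ : κ * κ = κ) (a : OrdTriangle H ⊕ OrdTriangle H) :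
    linearEval (edgeQuadric κ) (triangleRelation κ a) = 0 := by
  have hC : (C κ * C κ : MvPolynomial (Fin n ⊕ Fin n) K) = C κ := by rw [← C_mul, hκ]
  have hκ' : aeval (edgeQuadric κ : OrdEdge H → _) (C κ : MvPolynomial (OrdEdge H) K) = C κ := by
    simp
  rcases a with T | T
  · simp only [triangleRelation, map_add, map_sub, linearEval_single, map_mul, aeval_X, hκ']
    simp only [edgeQuadric, OrdTriangle.e₁, OrdTriangle.e₂, OrdTriangle.e₃]
    linear_combination (-(X (Sum.inr T.fst) * (X (Sum.inl T.lst) * X (Sum.inr T.mid)))) * hC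
  · simp only [triangleRelation, map_sub, linearEval_single, map_mul, aeval_X, hκ']
    simp only [edgeQuadric, OrdTriangle.e₁, OrdTriangle.e₂, OrdTriangle.e₃]
    linear_combination ((X (Sum.inl T.lst) * (X (Sum.inl T.mid) * X (Sum.inr T.fst)))) * hC

/-! ### Reduction to normal form modulo the triangle relations. -/

/-- Linear forms without reducible terms. -/
def reducedForms (H : SimpleGraph (Fin n)) (K : Type*) [Field K] :
    Submodule K (Fin n ⊕ Fin n → MvPolynomial (OrdEdge H) K) where
  carrier := {p | ∀ v α, coeff α (p v) ≠ 0 → ¬ Reducible v α}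
  zero_mem' := by simp
  add_mem' {p q} hp hq := by
    intro v α h
    by_cases h1 : coeff α (p v) = 0
    · by_cases h2 : coeff α (q v) = 0
      · simp [h1, h2] at h
      · exact hq v α h2
    · exact hp v α h1
  smul_mem' c p hp := by
    intro v α h
    refine hp v α fun h' => h ?_
    simp [h']

/-- The module generated by the linear relations of the triangles. -/
def relationModule (H : SimpleGraph (Fin n)) (κ : K) :
    Submodule (MvPolynomial (OrdEdge H) K) (Fin n ⊕ Fin n → MvPolynomial (OrdEdge H) K) :=
  Submodule.span _ (Set.range (triangleRelation κ))

/-- A measure that decreases when the leading term of a linear relation is replaced by the other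
terms. -/
def reductionMeasure (v : Fin n ⊕ Fin n) (α : OrdEdge H →₀ ℕ) : ℕ :=
  -- For i < j < k the factors 1, 3 and 2 give 3k + 2j > 3j + 2k and 3k + 2j > 3i + 2k for the first
  -- relation, and j + 2k > i + 2k and j + 2k > k + 2j for the second.
  Sum.elim (fun i : Fin n => (i : ℕ)) (fun j : Fin n => 3 * (j : ℕ)) v +
    Finsupp.weight (fun e : OrdEdge H => 2 * (e.snd : ℕ)) α

theorem reductionMeasure_add_single (v : Fin n ⊕ Fin n) (β : OrdEdge H →₀ ℕ) (e : OrdEdge H) :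
    reductionMeasure v (β + Finsupp.single e 1) =
      Sum.elim (fun i : Fin n => (i : ℕ)) (fun j : Fin n => 3 * (j : ℕ)) v +
        Finsupp.weight (fun e : OrdEdge H => 2 * (e.snd : ℕ)) β + 2 * e.snd := by
  simp [reductionMeasure, add_assoc, Finsupp.weight_single]

/-- A reducible term is replaced by the two other terms of a triangle relation, both of smaller
measure. -/
theorem single_monomial_mem (κ : K) (N : ℕ) : ∀ (v : Fin n ⊕ Fin n) (α : OrdEdge H →₀ ℕ),
    reductionMeasure v α = N → (Pi.single v (monomial α (1 : K)) : _ → _) ∈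
      reducedForms H K ⊔ (relationModule H κ).restrictScalars K := by
  classical
  induction N using Nat.strong_induction_on with
  | _ N ih =>
    intro v α hN
    by_cases hred : Reducible v α
    · obtain ⟨T, hT⟩ := hred
      have hl1 : (T.fst : ℕ) < T.mid := T.lt₁
      have hl2 : (T.mid : ℕ) < T.lst := T.lt₂
      have hrel : ∀ a, ∀ β : OrdEdge H →₀ ℕ, (monomial β (1 : K)) • triangleRelation κ a ∈
          reducedForms H K ⊔ (relationModule H κ).restrictScalars K := fun a β =>
        Submodule.mem_sup_right (Submodule.smul_mem (relationModule H κ) _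
          (Submodule.subset_span ⟨a, rfl⟩))
      have hmon : ∀ (β : OrdEdge H →₀ ℕ) e, monomial (β + Finsupp.single e 1) (1 : K) =
          monomial β 1 * X e := fun β e => by rw [X, monomial_mul, one_mul]
      have hsub : ∀ e, α e ≠ 0 → α - Finsupp.single e 1 + Finsupp.single e 1 = α := fun e he =>
        tsub_add_cancel_of_le (by
          rw [Finsupp.single_le_iff]
          omega)
      rcases hT with ⟨rfl, hα⟩ | ⟨rfl, hα⟩
      · set β := α - Finsupp.single T.e₁ 1 with hβ
        have hαβ := (hsub _ hα).symm
        rw [← hβ] at hαβ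
        rw [hαβ, reductionMeasure_add_single] at hN
        have h1 := ih _ (by
          rw [reductionMeasure_add_single, ← hN]
          simp only [Sum.elim_inr, OrdTriangle.e₁, OrdTriangle.e₂]
          omega) (Sum.inr T.mid) (β + Finsupp.single T.e₂ 1) rfl
        have h2 := ih _ (by
          rw [reductionMeasure_add_single, ← hN]
          simp only [Sum.elim_inr, OrdTriangle.e₁, OrdTriangle.e₃]
          omega) (Sum.inr T.fst) (β + Finsupp.single T.e₃ 1) rfl
        have h3 : (Pi.single (Sum.inr T.lst) (monomial α (1 : K)) :
            _ → MvPolynomial (OrdEdge H) K) =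
            monomial β (1 : K) • triangleRelation κ (Sum.inl T) +
              Pi.single (Sum.inr T.mid) (monomial (β + Finsupp.single T.e₂ 1) (1 : K)) -
              κ • (Pi.single (Sum.inr T.fst) (monomial (β + Finsupp.single T.e₃ 1) (1 : K)) :
                _ → MvPolynomial (OrdEdge H) K) := by
          rw [hαβ, hmon, hmon, hmon, triangleRelation]
          simp only [smul_add, smul_sub, ← Pi.single_smul, smul_eq_mul, smul_eq_C_mul]
          rw [mul_left_comm (monomial β 1) (C κ)]
          abel
        rw [h3]
        exact Submodule.sub_mem _ (Submodule.add_mem _ (hrel _ _) h1) (Submodule.smul_mem _ _ h2)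
      · set β := α - Finsupp.single T.e₂ 1 with hβ
        have hαβ := (hsub _ hα).symm
        rw [← hβ] at hαβ
        rw [hαβ, reductionMeasure_add_single] at hN
        have h1 := ih _ (by
          rw [reductionMeasure_add_single, ← hN]
          simp only [Sum.elim_inl, OrdTriangle.e₂, OrdTriangle.e₃]
          omega) (Sum.inl T.fst) (β + Finsupp.single T.e₃ 1) rfl
        have h2 := ih _ (by
          rw [reductionMeasure_add_single, ← hN]
          simp only [Sum.elim_inl, OrdTriangle.e₁, OrdTriangle.e₂]
          omega) (Sum.inl T.lst) (β + Finsupp.single T.e₁ 1) rfl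
        have h3 : (Pi.single (Sum.inl T.mid) (monomial α (1 : K)) :
            _ → MvPolynomial (OrdEdge H) K) =
            monomial β (1 : K) • triangleRelation κ (Sum.inr T) +
              Pi.single (Sum.inl T.fst) (monomial (β + Finsupp.single T.e₃ 1) (1 : K)) +
              κ • (Pi.single (Sum.inl T.lst) (monomial (β + Finsupp.single T.e₁ 1) (1 : K)) :
                _ → MvPolynomial (OrdEdge H) K) := by
          rw [hαβ, hmon, hmon, hmon, triangleRelation]
          simp only [smul_sub, ← Pi.single_smul, smul_eq_mul, smul_eq_C_mul]
          rw [mul_left_comm (monomial β 1) (C κ)]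
          abel
        rw [h3]
        exact Submodule.add_mem _ (Submodule.add_mem _ (hrel _ _) h1) (Submodule.smul_mem _ _ h2)
    · refine Submodule.mem_sup_left fun w β h => ?_
      by_cases hw : w = v
      · subst hw
        rw [Pi.single_eq_same, coeff_monomial] at h
        split_ifs at h with hαβ
        · rwa [← hαβ]
        · exact absurd rfl h
      · simp [hw] at h

theorem reducedForms_sup_relationModule (κ : K) :
    reducedForms H K ⊔ (relationModule H κ).restrictScalars K = ⊤ := by
  classical
  refine eq_top_iff.2 fun p _ => ?_
  have hp : p = ∑ v, Pi.single v (p v) := by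
    ext1 w
    simp [Finset.sum_apply, Pi.single_apply]
  rw [hp]
  refine Submodule.sum_mem _ fun v _ => ?_
  rw [← support_sum_monomial_coeff (p v), ← LinearMap.single_apply K, map_sum]
  refine Submodule.sum_mem _ fun α _ => ?_
  rw [← mul_one (coeff α (p v)), ← smul_eq_mul, ← smul_monomial, map_smul]
  exact Submodule.smul_mem _ _ (single_monomial_mem κ _ v α rfl)

/-- Irreducible terms evaluate to polynomials with distinct leading exponents, which are linearly
independent. -/
theorem eq_zero_of_mem_reducedForms (hH : IsClosedLabeled H) (hK : H.CliqueFree 4) (κ : K)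
    {p : Fin n ⊕ Fin n → MvPolynomial (OrdEdge H) K} (hp : p ∈ reducedForms H K)
    (h : linearEval (edgeQuadric κ) p = 0) : p = 0 := by
  classical
  let T : Finset (Σ _ : Fin n ⊕ Fin n, OrdEdge H →₀ ℕ) :=
    Finset.univ.sigma fun v => (p v).support
  have hT : ∀ k ∈ T, coeff k.2 (p k.1) ≠ 0 := fun k hk => by
    simpa [T] using hk
  have h1 : ∑ k ∈ T, C (coeff k.2 (p k.1)) * (monomial (Finsupp.single k.1 1) (1 : K) *
      aeval (edgeQuadric κ) (monomial k.2 (1 : K))) = 0 := by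
    rw [Finset.sum_sigma, ← h, linearEval_apply]
    refine Finset.sum_congr rfl fun v _ => ?_
    rw [aeval_eq_sum_support, Finset.mul_sum]
    refine Finset.sum_congr rfl fun α _ => ?_
    rw [X]
    ring
  have h2 := coeff_eq_zero_of_leadAt T
    (fun k _ => (leadAt_monomial (ω := edgeWeight) (Finsupp.single k.1 1)).mul
      (leadAt_aeval_monomial κ k.2)) (fun k hk l hl hkl => by
      obtain ⟨e1, e2⟩ := single_add_leadExp_injective hH hK hkl (hp _ _ (hT k hk))
        (hp _ _ (hT l hl))
      exact Sigma.ext e1 (heq_of_eq e2)) h1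
  ext v α
  by_contra hc
  exact hc (h2 ⟨v, α⟩ (by simpa [T] using hc))

/-- Modulo the relations every form is reduced, and a reduced form in the kernel vanishes; so the
triangle relations generate the kernel. -/
theorem linearEval_eq_zero_iff (hH : IsClosedLabeled H) (hK : H.CliqueFree 4) {κ : K}
    (hκ : κ * κ = κ) (p : Fin n ⊕ Fin n → MvPolynomial (OrdEdge H) K) :
    linearEval (edgeQuadric κ) p = 0 ↔
      ∃ μ : OrdTriangle H ⊕ OrdTriangle H → MvPolynomial (OrdEdge H) K,
        ∀ v, p v = ∑ a, μ a * triangleRelation κ a v := by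
  have hmem : ∀ q, q ∈ relationModule H κ ↔
      ∃ μ : OrdTriangle H ⊕ OrdTriangle H → MvPolynomial (OrdEdge H) K,
        ∀ v, q v = ∑ a, μ a * triangleRelation κ a v := by
    intro q
    rw [relationModule, Submodule.mem_span_range_iff_exists_fun]
    refine exists_congr fun μ => ?_
    rw [funext_iff]
    refine forall_congr' fun v => ?_
    rw [Finset.sum_apply, eq_comm]
    rfl
  have hzero : ∀ q ∈ relationModule H κ, linearEval (edgeQuadric κ) q = 0 := by
    intro q hq
    induction hq using Submodule.span_induction with
    | mem q hq =>
      obtain ⟨a, rfl⟩ := hq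
      exact linearEval_triangleRelation hκ a
    | zero => exact map_zero _
    | add q r _ _ hq hr => rw [map_add, hq, hr, add_zero]
    | smul P q _ hq => rw [linearEval_smul, hq, mul_zero]
  rw [← hmem]
  refine ⟨fun h => ?_, hzero p⟩
  obtain ⟨s, hs, r, hr, rfl⟩ := Submodule.mem_sup.1
    (show p ∈ reducedForms H K ⊔ (relationModule H κ).restrictScalars K by
      rw [reducedForms_sup_relationModule]; trivial)
  rw [map_add, hzero r hr, add_zero] at h
  rw [eq_zero_of_mem_reducedForms hH hK κ hs h, zero_add]
  exact hr

/-! ### Independence of the triangle relations. -/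

/-- The variable used to separate a linear relation from the others. -/
def pivot : OrdTriangle H ⊕ OrdTriangle H → Fin n ⊕ Fin n
  | Sum.inl T => Sum.inr T.lst
  | Sum.inr T => Sum.inl T.fst

/-- The matrix splits into two blocks, as one kind of relation involves only y's and the other only
x's. Each block is triangular, because a triangle is determined by its smallest vertex and also by
its largest one; the diagonal entries are variables up to sign. -/
theorem det_pivot_ne_zero (hH : IsClosedLabeled H) (hK : H.CliqueFree 4) (κ : K)
    [DecidableEq (OrdTriangle H ⊕ OrdTriangle H)] :
    (Matrix.of fun a b : OrdTriangle H ⊕ OrdTriangle H =>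
      triangleRelation κ a (pivot b)).det ≠ 0 := by
  rw [Ne, ← Matrix.exists_vecMul_eq_zero_iff]
  rintro ⟨μ, hμ0, hμ⟩
  have hcol : ∀ b, ∑ a, μ a * triangleRelation κ a (pivot b) = 0 := fun b => congrFun hμ b
  -- Another relation meeting the column of x at T.fst has that vertex as middle or last vertex, so
  -- its smallest vertex is smaller.
  have hr : ∀ N, ∀ T : OrdTriangle H, (T.fst : ℕ) = N → μ (Sum.inr T) = 0 := by
    intro N
    induction N using Nat.strong_induction_on with
    | _ N ih =>
      intro T hT
      have h := hcol (Sum.inr T)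
      rw [Finset.sum_eq_single (Sum.inr T)] at h
      · have h1 := T.lt₁.ne
        have h2 := (T.lt₁.trans T.lt₂).ne
        simpa [triangleRelation, pivot, h1, h2] using h
      · rintro (T' | T') _ hne
        · simp [triangleRelation, pivot]
        · have l1 := T'.lt₁
          have l2 := T'.lt₂
          by_cases hlt : T'.fst < T.fst
          · rw [ih T'.fst (by rw [← hT]; exact hlt) T' rfl, zero_mul]
          · have h0 : T.fst ≠ T'.fst := fun h => hne
              (congrArg Sum.inr (OrdTriangle.eq_of_fst_eq hH hK h.symm))
            have h1 : T.fst ≠ T'.mid := by omega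
            have h2 : T.fst ≠ T'.lst := by omega
            simp [triangleRelation, pivot, h0, h1, h2]
      · simp
  -- Here the triangles are taken in order of decreasing largest vertex, hence the induction on n
  -- minus that vertex.
  have hl : ∀ N, ∀ T : OrdTriangle H, n - (T.lst : ℕ) = N → μ (Sum.inl T) = 0 := by
    intro N
    induction N using Nat.strong_induction_on with
    | _ N ih =>
      intro T hT
      have h := hcol (Sum.inl T)
      rw [Finset.sum_eq_single (Sum.inl T)] at h
      · have h1 := T.lt₂.ne'
        have h2 := (T.lt₁.trans T.lt₂).ne'
        simpa [triangleRelation, pivot, h1, h2] using h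
      · rintro (T' | T') _ hne
        · have l1 := T'.lt₁
          have l2 := T'.lt₂
          by_cases hlt : T.lst < T'.lst
          · rw [ih (n - T'.lst) (by omega) T' rfl, zero_mul]
          · have h0 : T.lst ≠ T'.lst := fun h => hne
              (congrArg Sum.inl (OrdTriangle.eq_of_lst_eq hH hK h.symm))
            have h1 : T.lst ≠ T'.mid := by omega
            have h2 : T.lst ≠ T'.fst := by omega
            simp [triangleRelation, pivot, h0, h1, h2]
        · simp [triangleRelation, pivot]
      · simp
  refine hμ0 (funext ?_)
  rintro (T | T)
  · exact hl _ T rfl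
  · exact hr _ T rfl

theorem exists_dual (hH : IsClosedLabeled H) (hK : H.CliqueFree 4) (κ : K)
    [DecidableEq (OrdTriangle H ⊕ OrdTriangle H)] :
    ∃ (θ : OrdTriangle H ⊕ OrdTriangle H → Fin n ⊕ Fin n → MvPolynomial (OrdEdge H) K)
      (Δ : MvPolynomial (OrdEdge H) K), Δ ≠ 0 ∧
      ∀ a b, ∑ v, θ b v * triangleRelation κ a v = if a = b then Δ else 0 := by
  classical
  let M : Matrix (OrdTriangle H ⊕ OrdTriangle H) (OrdTriangle H ⊕ OrdTriangle H)
    (MvPolynomial (OrdEdge H) K) := Matrix.of fun a b => triangleRelation κ a (pivot b)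
  -- The dual vectors are the columns of the adjugate matrix, placed at the pivot variables, and Δ
  -- is the determinant.
  refine ⟨fun b v => ∑ c, if pivot c = v then M.adjugate c b else 0, M.det,
    det_pivot_ne_zero hH hK κ, fun a b => ?_⟩
  have h := congrFun (congrFun (Matrix.mul_adjugate M) a) b
  rw [Matrix.smul_apply, Matrix.one_apply, smul_eq_mul, mul_ite, mul_one, mul_zero] at h
  rw [← h, Matrix.mul_apply]
  simp_rw [Finset.sum_mul]
  rw [Finset.sum_comm]
  refine Finset.sum_congr rfl fun c _ => ?_
  simp [M, mul_comm]

end Relations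

/-! ### Powers of homogeneous ideals -/

section Powers

variable {σ K : Type*} [Field K]

theorem homogeneousComponent_mul_eq_sum (p q : MvPolynomial σ K) (k : ℕ) :
    homogeneousComponent k (p * q) = ∑ j ∈ Finset.range (p.totalDegree + 1),
      if j ≤ k then homogeneousComponent j p * homogeneousComponent (k - j) q else 0 := by
  conv_lhs => rw [← sum_homogeneousComponent p, Finset.sum_mul, map_sum]
  refine Finset.sum_congr rfl fun j _ => ?_
  split_ifs with h
  · have := homogeneousComponent_add_mul (homogeneousComponent_isHomogeneous j p) q (k - j)
    rwa [show j + (k - j) = k by omega] at this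
  · exact homogeneousComponent_mul_of_lt (homogeneousComponent_isHomogeneous j p) q (not_le.1 h)

theorem homogeneousComponent_mul_of_low {p q : MvPolynomial σ K} {d d' : ℕ}
    (hp : ∀ j < d, homogeneousComponent j p = 0) (hq : ∀ j < d', homogeneousComponent j q = 0) :
    (∀ k < d + d', homogeneousComponent k (p * q) = 0) ∧
      homogeneousComponent (d + d') (p * q) =
        homogeneousComponent d p * homogeneousComponent d' q := by
  constructor
  · intro k hk
    rw [homogeneousComponent_mul_eq_sum]
    refine Finset.sum_eq_zero fun j _ => ?_
    split_ifs with h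
    · by_cases hj : j < d
      · rw [hp j hj, zero_mul]
      · rw [hq (k - j) (by omega), mul_zero]
    · rfl
  · rw [homogeneousComponent_mul_eq_sum, Finset.sum_eq_single d]
    · rw [if_pos (by omega), Nat.add_sub_cancel_left]
    · intro j _ hj
      split_ifs with h
      · by_cases hj' : j < d
        · rw [hp j hj', zero_mul]
        · rw [hq (d + d' - j) (by omega), mul_zero]
      · rfl
    · intro h
      rw [Finset.mem_range] at h
      rw [homogeneousComponent_eq_zero d p (by omega)]
      simp

/-- The ideal contains the homogeneous components of its elements. -/
def HasComponents (I : Ideal (MvPolynomial σ K)) : Prop :=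
  ∀ p ∈ I, ∀ D, homogeneousComponent D p ∈ I

theorem HasComponents.mul {I J : Ideal (MvPolynomial σ K)} (hI : HasComponents I)
    (hJ : HasComponents J) : HasComponents (I * J) := by
  intro p hp D
  induction hp using Submodule.mul_induction_on' with
  | mem_mul_mem a ha b hb =>
    rw [homogeneousComponent_mul_eq_sum]
    refine Submodule.sum_mem _ fun j _ => ?_
    split_ifs
    · exact Ideal.mul_mem_mul (hI a ha _) (hJ b hb _)
    · exact Submodule.zero_mem _
  | add a _ b _ ha hb =>
    rw [map_add]
    exact Submodule.add_mem _ ha hb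

theorem HasComponents.pow {I : Ideal (MvPolynomial σ K)} (hI : HasComponents I) :
    ∀ m, HasComponents (I ^ m)
  | 0 => fun p _ D => by
    rw [pow_zero, Ideal.one_eq_top]
    trivial
  | m + 1 => by
    rw [pow_succ]
    exact (hI.pow m).mul hI

theorem hasComponents_span {S : Set (MvPolynomial σ K)}
    (hS : ∀ s ∈ S, ∃ d, s.IsHomogeneous d) : HasComponents (Ideal.span S) := by
  classical
  intro p hp
  induction hp using Submodule.span_induction with
  | mem s hs =>
    intro D
    obtain ⟨d, hd⟩ := hS s hs
    rw [homogeneousComponent_of_mem hd]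
    split_ifs
    · exact Ideal.subset_span hs
    · exact Submodule.zero_mem _
  | zero => intro D; rw [map_zero]; exact Submodule.zero_mem _
  | add p q _ _ hp hq =>
    intro D
    rw [map_add]
    exact Submodule.add_mem _ (hp D) (hq D)
  | smul r p _ hp =>
    intro D
    rw [smul_eq_mul, homogeneousComponent_mul_eq_sum]
    refine Submodule.sum_mem _ fun j _ => ?_
    split_ifs
    · exact Ideal.mul_mem_left _ _ (hp _)
    · exact Submodule.zero_mem _

/-- All components of degree less than `2` vanish, and the component of degree `2` lies in `U`. -/
def StartsIn (U : Submodule K (MvPolynomial σ K)) (p : MvPolynomial σ K) : Prop :=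
  (∀ k < 2, homogeneousComponent k p = 0) ∧ homogeneousComponent 2 p ∈ U

/-- A multiplier affects the component of degree 2 only through its constant term. -/
theorem startsIn_of_mem_span {U : Submodule K (MvPolynomial σ K)} {S : Set (MvPolynomial σ K)}
    (hS : ∀ s ∈ S, StartsIn U s) {p : MvPolynomial σ K} (hp : p ∈ Ideal.span S) :
    StartsIn U p := by
  induction hp using Submodule.span_induction with
  | mem s hs => exact hS s hs
  | zero => exact ⟨fun k _ => map_zero _, by rw [map_zero]; exact U.zero_mem⟩
  | add p q _ _ hp hq =>
    exact ⟨fun k hk => by rw [map_add, hp.1 k hk, hq.1 k hk, add_zero],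
      by rw [map_add]; exact U.add_mem hp.2 hq.2⟩
  | smul r p _ hp =>
    obtain ⟨h1, h2⟩ := homogeneousComponent_mul_of_low (p := r) (d := 0) (by simp) hp.1
    rw [zero_add] at h1 h2
    refine ⟨h1, ?_⟩
    rw [smul_eq_mul, h2, homogeneousComponent_zero, ← smul_eq_C_mul]
    exact U.smul_mem _ hp.2

theorem startsIn_of_isHomogeneous {U : Submodule K (MvPolynomial σ K)} {p : MvPolynomial σ K}
    (hp : p.IsHomogeneous 2) (h : p ∈ U) : StartsIn U p := by
  refine ⟨fun k hk => ?_, by rwa [homogeneousComponent_eq_self hp]⟩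
  classical
  rw [homogeneousComponent_of_mem hp, if_neg (by omega)]

/-- The lowest component of a product is the product of the lowest components, so only the quadrics
of J contribute. -/
theorem pow_lowest_component {E : Type*} {f : E → MvPolynomial σ K}
    {J : Ideal (MvPolynomial σ K)}
    (hJ : ∀ p ∈ J, StartsIn (Submodule.span K (Set.range f)) p) (m : ℕ) :
    ∀ p ∈ J ^ m, (∀ k < 2 * m, homogeneousComponent k p = 0) ∧
      ∃ P : MvPolynomial E K, P.IsHomogeneous m ∧ aeval f P = homogeneousComponent (2 * m) p := by
  induction m with
  | zero =>
    intro p _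
    refine ⟨fun k hk => by omega, C (coeff 0 p), isHomogeneous_C _ _, ?_⟩
    rw [mul_zero, homogeneousComponent_zero]
    simp
  | succ m ih =>
    have hU : ∀ q ∈ Submodule.span K (Set.range f),
        ∃ P : MvPolynomial E K, P.IsHomogeneous 1 ∧ aeval f P = q := by
      intro q hq
      induction hq using Submodule.span_induction with
      | mem q hq =>
        obtain ⟨e, rfl⟩ := hq
        exact ⟨X e, isHomogeneous_X K e, aeval_X f e⟩
      | zero => exact ⟨0, isHomogeneous_zero _ _ _, map_zero _⟩
      | add q r _ _ hq hr =>
        obtain ⟨P, hP, rfl⟩ := hq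
        obtain ⟨Q, hQ, rfl⟩ := hr
        exact ⟨P + Q, hP.add hQ, map_add _ _ _⟩
      | smul c q _ hq =>
        obtain ⟨P, hP, rfl⟩ := hq
        exact ⟨c • P, (homogeneousSubmodule E K 1).smul_mem c hP, map_smul _ _ _⟩
    intro p hp
    rw [pow_succ] at hp
    rw [show 2 * (m + 1) = 2 * m + 2 by ring]
    induction hp using Submodule.mul_induction_on' with
    | mem_mul_mem a ha b hb =>
      obtain ⟨h1, P, hP, hPa⟩ := ih a ha
      obtain ⟨h2, h3⟩ := hJ b hb
      obtain ⟨Q, hQ, hQb⟩ := hU _ h3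
      obtain ⟨h4, h5⟩ := homogeneousComponent_mul_of_low h1 h2
      exact ⟨h4, P * Q, hP.mul hQ, by rw [map_mul, hPa, hQb, h5]⟩
    | add a _ b _ ha hb =>
      obtain ⟨h1, P, hP, hPa⟩ := ha
      obtain ⟨h2, Q, hQ, hQb⟩ := hb
      exact ⟨fun k hk => by rw [map_add, h1 k hk, h2 k hk, add_zero], P + Q, hP.add hQ,
        by rw [map_add, map_add, hPa, hQb]⟩

theorem aeval_mem_pow {E : Type*} {f : E → MvPolynomial σ K} {J : Ideal (MvPolynomial σ K)}
    (hf : ∀ e, f e ∈ J) {m : ℕ} {P : MvPolynomial E K} (hP : P.IsHomogeneous m) :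
    aeval f P ∈ J ^ m := by
  rw [aeval_eq_sum_support]
  refine Submodule.sum_mem _ fun α hα => Ideal.mul_mem_left _ _ ?_
  have hdeg : α.degree = m := by
    rw [Finsupp.degree_eq_weight_one]
    exact hP (mem_support_iff.1 hα)
  rw [aeval_monomial, map_one, one_mul, ← hdeg, Finsupp.degree_apply, Finsupp.prod,
    ← Finset.prod_pow_eq_pow_sum]
  exact Ideal.prod_mem_prod fun e _ => Ideal.pow_mem_pow (hf e) _

end Powers

/-! ### Betti numbers of powers -/

section Main

variable {n : ℕ} {K : Type*} [Field K] {H : SimpleGraph (Fin n)}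

/-- Common form of both assertions: of J only gradedness and its quadrics are used, and `g` allows
the variables of the ring to carry labels other than those of H. -/
theorem hasGradedBetti_pow (hH : IsClosedLabeled H) (hK : H.CliqueFree 4) {κ : K}
    (hκ : κ * κ = κ) {σ : Type*} [Fintype σ] (g : Fin n ⊕ Fin n ≃ σ)
    {J : Ideal (MvPolynomial σ K)} (hJ : HasComponents J)
    (hJU : ∀ p ∈ J, StartsIn
      (Submodule.span K (Set.range fun e : OrdEdge H => rename g (edgeQuadric κ e))) p)
    (hmem : ∀ e : OrdEdge H, rename g (edgeQuadric κ e) ∈ J) (m i : ℕ) :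
    HasGradedBetti (J ^ m) i (2 * m + i)
      (linearStrandNumber (Fintype.card (OrdEdge H)) (Fintype.card (OrdTriangle H)) m i) := by
  refine ⟨nonempty_minimalGradedFreeResolution (hJ.pow m), fun F => ?_⟩
  -- An arbitrary order on the relations, needed only for the Koszul signs.
  let : LinearOrder (OrdTriangle H ⊕ OrdTriangle H) :=
    LinearOrder.lift' (Fintype.equivFin _) (Fintype.equivFin _).injective
  obtain ⟨θ, Δ, hΔ, hθ⟩ := exists_dual hH hK κ
  have hlow := pow_lowest_component hJU m
  have hrename : ∀ P : MvPolynomial (OrdEdge H) K,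
      aeval (fun e => rename g (edgeQuadric κ e)) P = rename g (aeval (edgeQuadric κ) P) :=
    fun P => (comp_aeval_apply (edgeQuadric κ) (rename g) P).symm
  have hinjg := rename_injective (R := K) g g.injective
  rw [betti_eq_of_linear_relations (ℓ := fun a v => triangleRelation κ a (g.symm v))
    (fun a v => isHomogeneous_triangleRelation κ a _)
    (f := fun e : OrdEdge H => rename g (edgeQuadric κ e))
    (fun e => (isHomogeneous_edgeQuadric κ e).rename_isHomogeneous)
    (fun P hP => ?_) (fun p => ?_)
    (θ := fun b v => θ b (g.symm v)) (fun a b => ?_) hΔ F m (fun p hp => (hlow p hp).1)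
    (fun P hP => aeval_mem_pow hmem hP) (fun p hp hpd => ?_) i]
  · unfold linearStrandNumber
    split_ifs with h
    · rw [Fintype.card_sum, ← two_mul, Nat.add_sub_assoc h]
    · rfl
  · rw [hrename] at hP
    exact aeval_edgeQuadric_injective hH hK κ P (hinjg (by rw [hP, map_zero]))
  · have h1 : ∑ v, X v * aeval (fun e => rename g (edgeQuadric κ e)) (p v) =
        rename g (linearEval (edgeQuadric κ) fun w => p (g w)) := by
      rw [linearEval_apply, map_sum, ← g.sum_comp]
      refine Finset.sum_congr rfl fun w _ => ?_
      rw [hrename, map_mul, rename_X]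
    rw [h1, map_eq_zero_iff _ hinjg, linearEval_eq_zero_iff hH hK hκ]
    refine exists_congr fun μ => ?_
    rw [← g.forall_congr_right]
    simp
  · rw [← hθ a b, ← g.symm.sum_comp]
  · obtain ⟨P, hP, hPp⟩ := (hlow p hp).2
    exact ⟨P, hP, by rw [hPp, homogeneousComponent_eq_self hpd]⟩

/-! ### Binomial edge ideals and relabeling of the vertices. -/

/-- The identification of the variables, with vertices renamed by `π`. -/
def varEquiv (π : Equiv.Perm (Fin n)) : Fin n ⊕ Fin n ≃ Vars n :=
  (Equiv.sumCongr π π).trans toLex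

theorem rename_edgeQuadric (π : Equiv.Perm (Fin n)) (κ : K) (e : OrdEdge H) :
    rename (varEquiv π) (edgeQuadric κ e) =
      x K (π e.fst) * y K (π e.snd) - C κ * (x K (π e.snd) * y K (π e.fst)) := by
  simp [edgeQuadric, varEquiv, x, y, Sum.inlₗ, Sum.inrₗ]

theorem isHomogeneous_rename_edgeQuadric (π : Equiv.Perm (Fin n)) (κ : K) (e : OrdEdge H) :
    (rename (varEquiv π) (edgeQuadric κ e)).IsHomogeneous 2 :=
  (isHomogeneous_edgeQuadric κ e).rename_isHomogeneous

theorem relabel_adj (G : SimpleGraph (Fin n)) (τ : Equiv.Perm (Fin n)) (a b : Fin n) :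
    (relabel G τ).Adj (τ a) (τ b) ↔ G.Adj a b :=
  SimpleGraph.map_adj_apply (f := τ.toEmbedding)

theorem relabel_adj_symm (G : SimpleGraph (Fin n)) (τ : Equiv.Perm (Fin n)) (a b : Fin n) :
    G.Adj (τ.symm a) (τ.symm b) ↔ (relabel G τ).Adj a b := by
  rw [← relabel_adj G τ, τ.apply_symm_apply, τ.apply_symm_apply]

/-- The closed labeling only orients the generators; renaming the variables by the inverse
permutation leaves the ideal in its original variables. -/
theorem binomialEdgeIdeal_eq_span (G : SimpleGraph (Fin n)) (τ : Equiv.Perm (Fin n)) :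
    binomialEdgeIdeal K G = Ideal.span
      (Set.range fun e : OrdEdge (relabel G τ) => rename (varEquiv τ.symm) (edgeQuadric (1 : K) e))
    := by
  refine le_antisymm (Ideal.span_le.2 ?_) (Ideal.span_le.2 ?_)
  · rintro _ ⟨i, j, hij, rfl⟩
    have hij' := (relabel_adj G τ i j).2 hij
    rcases hij'.ne.lt_or_gt with h | h
    · refine Ideal.subset_span ⟨⟨τ i, τ j, h, hij'⟩, ?_⟩
      simp [rename_edgeQuadric]
    · have : x K i * y K j - x K j * y K i =
          -rename (varEquiv τ.symm) (edgeQuadric (1 : K) ⟨τ j, τ i, h, hij'.symm⟩) := by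
        simp [rename_edgeQuadric]
      rw [this]
      exact Submodule.neg_mem _ (Ideal.subset_span ⟨_, rfl⟩)
  · rintro _ ⟨e, rfl⟩
    refine Ideal.subset_span ⟨τ.symm e.fst, τ.symm e.snd,
      (relabel_adj_symm G τ _ _).2 e.adj, ?_⟩
    simp only [rename_edgeQuadric, C_1, one_mul]

theorem startsIn_binomialEdgeIdeal (G : SimpleGraph (Fin n)) (τ : Equiv.Perm (Fin n)) :
    ∀ p ∈ binomialEdgeIdeal K G, StartsIn (Submodule.span K
      (Set.range fun e : OrdEdge (relabel G τ) =>
        rename (varEquiv τ.symm) (edgeQuadric (1 : K) e))) p := by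
  intro p hp
  rw [binomialEdgeIdeal_eq_span G τ] at hp
  refine startsIn_of_mem_span ?_ hp
  rintro _ ⟨e, rfl⟩
  exact startsIn_of_isHomogeneous (isHomogeneous_rename_edgeQuadric _ _ e)
    (Submodule.subset_span ⟨e, rfl⟩)

theorem hasComponents_binomialEdgeIdeal (G : SimpleGraph (Fin n)) :
    HasComponents (binomialEdgeIdeal K G) := by
  refine hasComponents_span ?_
  rintro _ ⟨i, j, -, rfl⟩
  exact ⟨2, ((isHomogeneous_X K _).mul (isHomogeneous_X K _)).sub
    ((isHomogeneous_X K _).mul (isHomogeneous_X K _))⟩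

/-! ### The lexicographic initial ideal -/

/-- The exponent of `xᵢ yⱼ`. -/
def xyExp (i j : Fin n) : Vars n →₀ ℕ :=
  Finsupp.single (Sum.inlₗ i) 1 + Finsupp.single (Sum.inrₗ j) 1

theorem x_mul_y (i j : Fin n) : x K i * y K j = monomial (xyExp i j) 1 := by
  rw [x, y, X, X, monomial_mul, one_mul, xyExp]

theorem xyExp_inj {i j k l : Fin n} : xyExp i j = xyExp k l ↔ i = k ∧ j = l := by
  refine ⟨fun h => ?_, fun h => by rw [h.1, h.2]⟩
  have h1 := DFunLike.congr_fun h (Sum.inlₗ i)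
  have h2 := DFunLike.congr_fun h (Sum.inrₗ j)
  simp only [xyExp, Finsupp.add_apply, Finsupp.single_apply, Sum.inlₗ, Sum.inrₗ,
    EmbeddingLike.apply_eq_iff_eq, Sum.inl.injEq, Sum.inr.injEq, reduceCtorEq, if_false] at h1 h2
  constructor
  · by_contra hc
    simp [Ne.symm hc] at h1
  · by_contra hc
    simp [Ne.symm hc] at h2

open scoped MonomialOrder in
theorem xyExp_lt {i j : Fin n} (h : i < j) : xyExp j i ≺[MonomialOrder.lex] xyExp i j := by
  rw [MonomialOrder.lex_lt_iff, Finsupp.Lex.lt_iff]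
  refine ⟨Sum.inlₗ i, fun v hv => ?_, ?_⟩
  · induction v using Lex.rec with
    | _ v =>
      rcases v with k | k
      · have hk : k < i := by simpa [Sum.inlₗ] using hv
        have hkj := (hk.trans h).ne
        simp [xyExp, Sum.inlₗ, Sum.inrₗ, hk.ne', hkj.symm]
      · exact absurd hv (by simp [Sum.inlₗ])
  · simp [xyExp, Sum.inlₗ, Sum.inrₗ, h.ne']

theorem rename_edgeQuadric_one (e : OrdEdge H) :
    rename (varEquiv (1 : Equiv.Perm (Fin n)).symm) (edgeQuadric (1 : K) e) =
      monomial (xyExp e.fst e.snd) 1 - monomial (xyExp e.snd e.fst) 1 := by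
  have h : (1 : Equiv.Perm (Fin n)).symm = 1 := rfl
  rw [h, rename_edgeQuadric, ← x_mul_y, ← x_mul_y]
  simp

theorem rename_edgeQuadric_zero (e : OrdEdge H) :
    rename (varEquiv 1) (edgeQuadric (0 : K) e) = monomial (xyExp e.fst e.snd) 1 := by
  rw [rename_edgeQuadric, ← x_mul_y]
  simp

theorem lex_degree_edge (e : OrdEdge H) :
    MonomialOrder.lex.degree (monomial (xyExp e.fst e.snd) (1 : K) -
      monomial (xyExp e.snd e.fst) 1) = xyExp e.fst e.snd := by
  classical
  rw [MonomialOrder.degree_sub_of_lt, MonomialOrder.degree_monomial, if_neg one_ne_zero]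
  rw [MonomialOrder.degree_monomial, MonomialOrder.degree_monomial, if_neg one_ne_zero,
    if_neg one_ne_zero]
  exact xyExp_lt e.lt

theorem relabel_one (H : SimpleGraph (Fin n)) : relabel H 1 = H := by
  ext a b
  exact relabel_adj H 1 a b

theorem binomialEdgeIdeal_startsIn (H : SimpleGraph (Fin n)) :
    ∀ p ∈ binomialEdgeIdeal K H, StartsIn (Submodule.span K
      (Set.range fun e : OrdEdge H => (monomial (xyExp e.fst e.snd) (1 : K) -
        monomial (xyExp e.snd e.fst) 1))) p := by
  have := startsIn_binomialEdgeIdeal (K := K) H 1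
  rw [relabel_one] at this
  simpa only [rename_edgeQuadric_one] using this

/-- The quadratic part of f is a combination of edge binomials with pairwise disjoint supports. If
its leading monomial were the second term of a binomial, the first term would occur in f with a
nonzero coefficient and be lexicographically larger. -/
theorem lex_degree_eq_of_degree_eq_two {f : PolyRing K n} (hf : f ∈ binomialEdgeIdeal K H)
    (hf0 : f ≠ 0) (hdeg : (MonomialOrder.lex.degree f).degree = 2) :
    ∃ e : OrdEdge H, MonomialOrder.lex.degree f = xyExp e.fst e.snd := by
  classical
  set δ := MonomialOrder.lex.degree f with hδ
  obtain ⟨c, hc⟩ := (Submodule.mem_span_range_iff_exists_fun K).1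
    (binomialEdgeIdeal_startsIn H f hf).2
  have hcoeff : ∀ ν : Vars n →₀ ℕ, ν.degree = 2 → coeff ν f = ∑ e : OrdEdge H,
      c e * ((if xyExp e.fst e.snd = ν then 1 else 0) - if xyExp e.snd e.fst = ν then 1 else 0) := by
    intro ν hν
    have h1 : coeff ν (homogeneousComponent 2 f) = coeff ν f := by
      rw [coeff_homogeneousComponent, if_pos hν]
    rw [← h1, ← hc, coeff_sum]
    refine Finset.sum_congr rfl fun e _ => ?_
    rw [coeff_smul, coeff_sub, coeff_monomial, coeff_monomial, smul_eq_mul]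
  have h0 : coeff δ f ≠ 0 := MonomialOrder.coeff_degree_ne_zero_iff.2 hf0
  rw [hcoeff δ hdeg] at h0
  obtain ⟨e, -, he⟩ := Finset.exists_ne_zero_of_sum_ne_zero h0
  have hce := left_ne_zero_of_mul he
  by_cases h1 : xyExp e.fst e.snd = δ
  · exact ⟨e, h1.symm⟩
  have h2 : xyExp e.snd e.fst = δ := by
    by_contra h2
    simp [h1, h2] at he
  exfalso
  have hd : (xyExp e.fst e.snd).degree = 2 := by
    simp [xyExp, Finsupp.degree_single]
  have h3 : coeff (xyExp e.fst e.snd) f = c e := by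
    rw [hcoeff _ hd, Finset.sum_eq_single e]
    · have : ¬ (e.snd = e.fst ∧ e.fst = e.snd) := fun h => e.lt.ne' h.1
      simp [xyExp_inj, this]
    · intro e' _ hne
      have a1 : ¬ (e'.fst = e.fst ∧ e'.snd = e.snd) := fun h => hne (OrdEdge.ext h.1 h.2)
      have a2 : ¬ (e'.snd = e.fst ∧ e'.fst = e.snd) := fun h => by
        have := e.lt
        rw [← h.1, ← h.2] at this
        exact absurd e'.lt this.not_gt
      simp [xyExp_inj, a1, a2]
    · simp
  have h4 := MonomialOrder.lex.le_degree (mem_support_iff.2 (h3.trans_ne hce))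
  rw [← hδ, ← h2] at h4
  exact absurd (xyExp_lt e.lt) (not_lt.2 h4)

theorem hasComponents_lexInitialIdeal (I : Ideal (PolyRing K n)) :
    HasComponents (lexInitialIdeal I) := by
  refine hasComponents_span ?_
  rintro _ ⟨f, -, -, rfl⟩
  exact ⟨_, isHomogeneous_monomial _ rfl⟩

/-- Leading monomials of degree above 2 do not reach the quadratic part, and none has degree below
2; so no knowledge of the higher generators is needed. -/
theorem startsIn_lexInitialIdeal : ∀ p ∈ lexInitialIdeal (binomialEdgeIdeal K H),
    StartsIn (Submodule.span K
      (Set.range fun e : OrdEdge H => rename (varEquiv 1) (edgeQuadric (0 : K) e))) p := by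
  classical
  intro p hp
  refine startsIn_of_mem_span ?_ hp
  rintro _ ⟨f, hf, hf0, rfl⟩
  set δ := MonomialOrder.lex.degree f with hδ
  have h0 : coeff δ f ≠ 0 := MonomialOrder.coeff_degree_ne_zero_iff.2 hf0
  have hhom : (monomial δ (1 : K)).IsHomogeneous δ.degree := isHomogeneous_monomial _ rfl
  by_cases h2 : δ.degree = 2
  · obtain ⟨e, he⟩ := lex_degree_eq_of_degree_eq_two hf hf0 h2
    rw [h2] at hhom
    refine startsIn_of_isHomogeneous hhom (Submodule.subset_span ⟨e, ?_⟩)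
    exact (rename_edgeQuadric_zero e).trans (congrArg (fun d => monomial d (1 : K)) he.symm)
  · have h3 : ∀ k ≤ 2, k ≠ δ.degree := by
      intro k hk hkδ
      have hk2 : k < 2 := by omega
      refine h0 ?_
      have := congrArg (coeff δ) ((binomialEdgeIdeal_startsIn H f hf).1 k hk2)
      rwa [coeff_homogeneousComponent, if_pos hkδ.symm, coeff_zero] at this
    refine ⟨fun k hk => ?_, ?_⟩
    · rw [homogeneousComponent_of_mem hhom, if_neg (h3 k hk.le)]
    · rw [homogeneousComponent_of_mem hhom, if_neg (h3 2 le_rfl)]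
      exact Submodule.zero_mem _

theorem rename_edgeQuadric_zero_mem (e : OrdEdge H) :
    rename (varEquiv 1) (edgeQuadric (0 : K) e) ∈ lexInitialIdeal (binomialEdgeIdeal K H) := by
  classical
  have hdeg := lex_degree_edge (K := K) e
  refine Ideal.subset_span ⟨monomial (xyExp e.fst e.snd) (1 : K) -
    monomial (xyExp e.snd e.fst) 1, ?_, ?_, ?_⟩
  · rw [← x_mul_y, ← x_mul_y]
    exact Ideal.subset_span ⟨e.fst, e.snd, e.adj, rfl⟩
  · intro h
    have := congrArg (coeff (xyExp e.fst e.snd)) h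
    rw [coeff_sub, coeff_monomial, coeff_monomial, if_pos rfl, if_neg] at this
    · simp at this
    · rw [xyExp_inj]
      exact fun h => e.lt.ne' h.1
  · rw [hdeg, rename_edgeQuadric_zero]

/-! ### Relabeling -/

theorem relabel_cliqueFree {G : SimpleGraph (Fin n)} (hK : G.CliqueFree 4)
    (τ : Equiv.Perm (Fin n)) : (relabel G τ).CliqueFree 4 :=
  hK.comap (SimpleGraph.Iso.map τ G).symm.toEmbedding.toCopy.isContained

theorem card_ordEdge_relabel (G : SimpleGraph (Fin n)) (τ : Equiv.Perm (Fin n)) :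
    Fintype.card (OrdEdge (relabel G τ)) = G.edgeSet.ncard := by
  rw [card_ordEdge, ← Nat.card_coe_set_eq, ← Nat.card_coe_set_eq]
  exact (Nat.card_congr (SimpleGraph.Iso.map τ G).mapEdgeSet).symm

theorem card_ordTriangle_relabel (G : SimpleGraph (Fin n)) (τ : Equiv.Perm (Fin n)) :
    Fintype.card (OrdTriangle (relabel G τ)) = (G.cliqueSet 3).ncard := by
  rw [card_ordTriangle]
  have : (relabel G τ).cliqueSet 3 = Finset.map τ.toEmbedding '' G.cliqueSet 3 :=
    SimpleGraph.cliqueSet_map_of_equiv G τ 3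
  rw [this]
  exact Set.ncard_image_of_injective _ (Finset.map_injective _)

end Main

end BinomialEdge

end

theorem theorem3p5 (K : Type*) [Field K] (n : ℕ) (G : SimpleGraph (Fin n))
    (hG : BinomialEdge.IsClosedGraph G) (hK4 : G.CliqueFree 4)
    (e t : ℕ) (he : e = G.edgeSet.ncard) (ht : t = (G.cliqueSet 3).ncard)
    (m i : ℕ) (hm : 1 ≤ m) :
    BinomialEdge.HasGradedBetti (BinomialEdge.binomialEdgeIdeal K G ^ m) i (2 * m + i)
      (BinomialEdge.linearStrandNumber e t m i) ∧
    ∀ τ : Equiv.Perm (Fin n),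
      BinomialEdge.IsClosedLabeled (BinomialEdge.relabel G τ) →
      BinomialEdge.HasGradedBetti
        (BinomialEdge.lexInitialIdeal
          (BinomialEdge.binomialEdgeIdeal K (BinomialEdge.relabel G τ)) ^ m) i (2 * m + i)
        (BinomialEdge.linearStrandNumber e t m i) := by
  constructor
  · obtain ⟨τ, hτ⟩ := hG
    -- Case κ = 1: the closed labeling serves for the combinatorics, and `τ.symm` translates back to
    -- the variables of G.
    have := BinomialEdge.hasGradedBetti_pow hτ (BinomialEdge.relabel_cliqueFree hK4 τ)
      (one_mul (1 : K)) (BinomialEdge.varEquiv τ.symm)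
      (BinomialEdge.hasComponents_binomialEdgeIdeal G)
      (BinomialEdge.startsIn_binomialEdgeIdeal G τ) (fun e => by
        rw [BinomialEdge.binomialEdgeIdeal_eq_span G τ]
        exact Ideal.subset_span ⟨e, rfl⟩) m i
    rwa [BinomialEdge.card_ordEdge_relabel, BinomialEdge.card_ordTriangle_relabel, ← he,
      ← ht] at this
  · intro τ hτ
    -- Case κ = 0: the initial ideal depends on the labeling, so it is taken for the relabeled graph
    -- itself and no renaming occurs.
    have := BinomialEdge.hasGradedBetti_pow hτ (BinomialEdge.relabel_cliqueFree hK4 τ)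
      (mul_zero (0 : K)) (BinomialEdge.varEquiv 1)
      (BinomialEdge.hasComponents_lexInitialIdeal _)
      BinomialEdge.startsIn_lexInitialIdeal BinomialEdge.rename_edgeQuadric_zero_mem m i
    rwa [BinomialEdge.card_ordEdge_relabel, BinomialEdge.card_ordTriangle_relabel, ← he,
      ← ht] at this
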